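/- Let $T\ge 0$ and let $\Omega=R^+[0,T]$ be the set of all right-continuous functions $\omega:[0,T]\to[0,\infty)$. For $t\in[0,T]$ let $\mathcal F^\circ_t$ be the smallest $\sigma$-algebra on $\Omega$ making all $\omega\mapsto\omega(s)$, $s\in[0,t]$, measurable, and let $\mathcal F_t$ be its universal completion. Stopping times $\tau:\Omega\to[0,T]\cup\{\infty\}$ and the $\sigma$-algebras $\mathcal F_\tau$ are taken with respect to $(\mathcal F_t)$. A *simple trading strategy* $G$ consists of an initial capital $c\in\mathbb R$, stopping times $\tau_1\le\tau_2\le\cdots$ such that for every $\omega\in\Omega$ only finitely many $\tau_n(\omega)$ are finite, and, for each $n\ge1$, a bounded $\mathcal F_{\tau_n}$-measurable function $h_n:\Omega\to\mathbb R$. Its capital process is $$\mathcal K^G_t(\omega)=c+\sum_{n=1}^\infty h_n(\omega)\bigl(\omega(\tau_{n+1}\wedge t)-\omega(\tau_n\wedge t)\bigr),\qquad t\in[0,T].$$ A *positive capital process* is an adapted process $S$ with values in $[0,\infty]$ of the form $S_t(\omega)=\sum_{m=1}^\infty\mathcal K^{G_m}_t(\omega)$, where $G_1,G_2,\ldots$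 are simple trading strategies with $\mathcal K^{G_m}_t(\omega)\ge0$ for all $m$, $t\in[0,T]$ and $\omega\in\Omega$, whose initial capitals $c_m$ satisfy $\sum_m c_m<\infty$. A set $E\subseteq\Omega$ is *null* if there is a positive capital process $S$ with $S_0=1$ and $S_T(\omega)=\infty$ for all $\omega\in E$. A property holds *for typical* $\omega\in\Omega$ if the set of $\omega\in\Omega$ where it fails is null. For $p>0$ and $f:[0,T]\to\mathbb R$ let $\mathrm{var}_p(f)=\sup\sum_{i=1}^n|f(t_i)-f(t_{i-1})|^p$, the supremum being over all $n\ge1$ and all $0=t_0\le t_1\le\cdots\le t_n=T$. The *variation index* $\mathrm{vi}(f)\in[0,\infty]$ is the unique number such that $\mathrm{var}_p(f)<\infty$ for $p>\mathrm{vi}(f)$ and $\mathrm{var}_p(f)=\infty$ for $0<p<\mathrm{vi}(f)$. **Proposition.** For typical $\omega\in R^+[0,T]$, $\mathrm{vi}(\omega)\le2$. -/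

import Mathlib

open MeasureTheory Filter Topology
open scoped ENNReal

noncomputable section

namespace RCPath

/-- The sample space `R⁺[0,T]`: all right-continuous functions `ω : [0,T] → [0,∞)`. -/
def Path (T : ℝ) : Type :=
  {ω : Set.Icc (0 : ℝ) T → ℝ //
    (∀ t, 0 ≤ ω t) ∧ ∀ t, ContinuousWithinAt ω (Set.Ici t) t}

variable {T : ℝ}

instance : CoeFun (Path T) (fun _ => Set.Icc (0 : ℝ) T → ℝ) := ⟨Subtype.val⟩

/-- The universal completion of a σ-algebra `m`: a set belongs to it iff it belongs to the
completion of `m` with respect to every probability measure on `m`. -/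
@[reducible] def univCompletion {Ω : Type*} (m : MeasurableSpace Ω) : MeasurableSpace Ω where
  MeasurableSet' s := ∀ μ : @Measure Ω m, IsProbabilityMeasure μ → NullMeasurableSet s μ
  measurableSet_empty := fun _ _ => nullMeasurableSet_empty
  measurableSet_compl := fun _ hs μ hμ => (hs μ hμ).compl
  measurableSet_iUnion := fun _ hs μ hμ => NullMeasurableSet.iUnion fun i => hs i μ hμ

theorem le_univCompletion {Ω : Type*} (m : MeasurableSpace Ω) : m ≤ univCompletion m :=
  fun _ hs _ _ => MeasurableSet.nullMeasurableSet hs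

theorem univCompletion_mono {Ω : Type*} {m₁ m₂ : MeasurableSpace Ω} (h : m₁ ≤ m₂) :
    univCompletion m₁ ≤ univCompletion m₂ := by
  intro s hs μ hμ
  have h1 : @IsProbabilityMeasure Ω m₁ (μ.trim h) :=
    @IsProbabilityMeasure.mk Ω m₁ _ (by rw [trim_measurableSet_eq h .univ]; exact measure_univ)
  obtain ⟨t, ht, hst⟩ := hs (μ.trim h) h1
  exact ⟨t, h t ht, ae_eq_of_ae_eq_trim hst⟩

/-- `𝓕°_t`: the smallest σ-algebra on `R⁺[0,T]` making all `ω ↦ ω(s)`, `s ∈ [0,t]`, measurable. -/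
@[reducible] def rawSigma (T : ℝ) (t : Set.Icc (0 : ℝ) T) : MeasurableSpace (Path T) :=
  ⨆ s ∈ Set.Iic t, MeasurableSpace.comap (fun ω : Path T => ω s) (borel ℝ)

/-- The smallest σ-algebra on `R⁺[0,T]` making all `ω ↦ ω(s)`, `s ∈ [0,T]`, measurable. -/
@[reducible] def rawSigmaAll (T : ℝ) : MeasurableSpace (Path T) :=
  ⨆ s : Set.Icc (0 : ℝ) T, MeasurableSpace.comap (fun ω : Path T => ω s) (borel ℝ)

/-- The filtration `(𝓕_t)`, `𝓕_t` being the universal completion of `𝓕°_t`. -/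
def pathFiltration (T : ℝ) :
    Filtration (Set.Icc (0 : ℝ) T) (univCompletion (rawSigmaAll T)) where
  seq t := univCompletion (rawSigma T t)
  mono' := fun _ _ hst => univCompletion_mono (biSup_mono fun _ hr => le_trans hr hst)
  le' := fun _ => univCompletion_mono (iSup₂_le fun s _ => le_iSup
    (fun s : Set.Icc (0 : ℝ) T => MeasurableSpace.comap (fun ω : Path T => ω s) (borel ℝ)) s)

/-- A simple trading strategy: initial capital `c`, stopping times `τ 0 ≤ τ 1 ≤ ⋯` with values in
`[0,T] ∪ {∞}`, only finitely many of which are finite on each path, and bounded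
`𝓕_{τ n}`-measurable positions `h n`. -/
structure SimpleStrategy (T : ℝ) where
  c : ℝ
  τ : ℕ → Path T → WithTop (Set.Icc (0 : ℝ) T)
  isStoppingTime : ∀ n, IsStoppingTime (pathFiltration T) (τ n)
  mono : ∀ n ω, τ n ω ≤ τ (n + 1) ω
  finite : ∀ ω, {n | τ n ω ≠ ⊤}.Finite
  h : ℕ → Path T → ℝ
  bounded : ∀ n, ∃ C, ∀ ω, |h n ω| ≤ C
  measurable : ∀ n, Measurable[(isStoppingTime n).measurableSpace] (h n)

/-- The time `τ ∧ t ∈ [0,T]`. -/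
def capAt (τ : WithTop (Set.Icc (0 : ℝ) T)) (t : Set.Icc (0 : ℝ) T) : Set.Icc (0 : ℝ) T :=
  min (τ.untopD t) t

/-- The capital process
`K_t(ω) = c + ∑ₙ hₙ(ω) (ω(τₙ₊₁ ∧ t) - ω(τₙ ∧ t))`; the sum has finitely many nonzero terms. -/
def SimpleStrategy.capital (G : SimpleStrategy T) (t : Set.Icc (0 : ℝ) T) (ω : Path T) : ℝ :=
  G.c + ∑ᶠ n, G.h n ω * (ω (capAt (G.τ (n + 1) ω) t) - ω (capAt (G.τ n ω) t))

/-- A positive capital process: a process (adapted to `(𝓕_t)`) that is a sum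
`S_t = ∑ₘ K^{G m}_t` of positive simple capital processes whose initial capitals have a
convergent sum; it may take the value `∞`. -/
def IsPositiveCapitalProcess (S : Set.Icc (0 : ℝ) T → Path T → ℝ≥0∞) : Prop :=
  (∀ t, Measurable[pathFiltration T t] (S t)) ∧
  ∃ G : ℕ → SimpleStrategy T,
    (∀ m t ω, 0 ≤ (G m).capital t ω) ∧
    Summable (fun m => (G m).c) ∧
    ∀ t ω, S t ω = ∑' m, ENNReal.ofReal ((G m).capital t ω)

/-- `E` is null: some positive capital process has `S_0 = 1` and `S_T = ∞` on `E`. -/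
def IsNull (hT : 0 ≤ T) (E : Set (Path T)) : Prop :=
  ∃ S : Set.Icc (0 : ℝ) T → Path T → ℝ≥0∞, IsPositiveCapitalProcess S ∧
    (∀ ω, S ⟨0, Set.left_mem_Icc.2 hT⟩ ω = 1) ∧
    ∀ ω ∈ E, S ⟨T, Set.right_mem_Icc.2 hT⟩ ω = ∞

/-- A property holds for typical `ω` if the set of `ω` where it fails is null. -/
def ForTypical (hT : 0 ≤ T) (P : Path T → Prop) : Prop :=
  IsNull hT {ω | ¬ P ω}

/-- The `p`-variation `sup ∑_{i=1}^n |f(t_i) - f(t_{i-1})|^p` over all `n ≥ 1` and all partitions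
`0 = t_0 ≤ t_1 ≤ ⋯ ≤ t_n = T`. -/
def pVariation (p : ℝ) (f : Set.Icc (0 : ℝ) T → ℝ) : ℝ≥0∞ :=
  ⨆ (n : ℕ) (_ : 1 ≤ n) (κ : Fin (n + 1) → Set.Icc (0 : ℝ) T)
    (_ : Monotone κ ∧ (κ 0 : ℝ) = 0 ∧ (κ (Fin.last n) : ℝ) = T),
    ∑ i : Fin n, ENNReal.ofReal (|f (κ i.succ) - f (κ i.castSucc)| ^ p)

/-- The variation index `vi(f) ∈ [0,∞]`: the `p`-variation is finite for `p > vi(f)` and infinite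
for `0 < p < vi(f)`, see `pVariation_lt_top` and `pVariation_eq_top`. -/
def variationIndex (f : Set.Icc (0 : ℝ) T → ℝ) : ℝ≥0∞ :=
  sInf {v | ∃ p : ℝ, 0 < p ∧ pVariation p f < ∞ ∧ v = ENNReal.ofReal p}

theorem pVariation_eq_top {f : Set.Icc (0 : ℝ) T → ℝ} {p : ℝ} (hp : 0 < p)
    (h : ENNReal.ofReal p < variationIndex f) : pVariation p f = ∞ := by
  by_contra hne
  refine absurd h (not_lt.2 (sInf_le ?_))
  exact ⟨p, hp, lt_top_iff_ne_top.2 hne, rfl⟩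

theorem pVariation_lt_top {f : Set.Icc (0 : ℝ) T → ℝ} {p : ℝ}
    (h : variationIndex f < ENNReal.ofReal p) : pVariation p f < ∞ := by
  obtain ⟨_, ⟨q, hq, hfin, rfl⟩, hlt⟩ := sInf_lt_iff.1 h
  have hqp : q < p := (ENNReal.ofReal_lt_ofReal_iff_of_nonneg hq.le).1 hlt
  set M := pVariation q f with hM
  have hr : 0 ≤ (p - q) / q := div_nonneg (sub_nonneg.2 hqp.le) hq.le
  refine lt_of_le_of_lt ?_ (ENNReal.mul_lt_top hfin (ENNReal.rpow_lt_top_of_nonneg hr hfin.ne))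
  refine iSup_le fun n => iSup_le fun hn => iSup_le fun κ => iSup_le fun hκ => ?_
  have hsum : ∑ i : Fin n, ENNReal.ofReal (|f (κ i.succ) - f (κ i.castSucc)| ^ q) ≤ M := by
    rw [hM]
    exact le_iSup_of_le n (le_iSup_of_le hn (le_iSup_of_le κ (le_iSup_of_le hκ le_rfl)))
  calc ∑ i : Fin n, ENNReal.ofReal (|f (κ i.succ) - f (κ i.castSucc)| ^ p)
      ≤ ∑ i : Fin n, ENNReal.ofReal (|f (κ i.succ) - f (κ i.castSucc)| ^ q)
          * M ^ ((p - q) / q) := by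
        refine Finset.sum_le_sum fun i hi => ?_
        set a := |f (κ i.succ) - f (κ i.castSucc)| with ha
        have ha0 : 0 ≤ a := abs_nonneg _
        have h1 : a ^ p = a ^ q * (a ^ q) ^ ((p - q) / q) := by
          rw [← Real.rpow_mul ha0, mul_div_cancel₀ _ hq.ne', ← Real.rpow_add_of_nonneg ha0 hq.le
            (sub_nonneg.2 hqp.le)]
          congr 1; ring
        rw [h1, ENNReal.ofReal_mul (by positivity),
          ← ENNReal.ofReal_rpow_of_nonneg (by positivity) hr]
        gcongr
        exact (Finset.single_le_sum
          (f := fun i : Fin n => ENNReal.ofReal (|f (κ i.succ) - f (κ i.castSucc)| ^ q))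
          (fun _ _ => zero_le) hi).trans hsum
    _ = (∑ i : Fin n, ENNReal.ofReal (|f (κ i.succ) - f (κ i.castSucc)| ^ q))
          * M ^ ((p - q) / q) := (Finset.sum_mul _ _ _).symm
    _ ≤ M * M ^ ((p - q) / q) := by gcongr

/-- The sum in `SimpleStrategy.capital` is finite. -/
theorem SimpleStrategy.finite_support (G : SimpleStrategy T) (t : Set.Icc (0 : ℝ) T)
    (ω : Path T) : (Function.support fun n =>
      G.h n ω * (ω (capAt (G.τ (n + 1) ω) t) - ω (capAt (G.τ n ω) t))).Finite := by
  refine (G.finite ω).subset fun n hn htop => hn ?_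
  have h2 : G.τ (n + 1) ω = ⊤ := top_le_iff.1 (htop ▸ G.mono n ω)
  simp [htop, h2]

theorem capAt_le (τ : WithTop (Set.Icc (0 : ℝ) T)) (t : Set.Icc (0 : ℝ) T) : capAt τ t ≤ t :=
  min_le_right _ _

theorem measurable_coord {s t : Set.Icc (0 : ℝ) T} (hst : s ≤ t) :
    Measurable[pathFiltration T t] (fun ω : Path T => ω s) := by
  have h : MeasurableSpace.comap (fun ω : Path T => ω s) (borel ℝ) ≤ pathFiltration T t :=
    le_trans (le_iSup₂_of_le (f := fun (s : Set.Icc (0 : ℝ) T) (_ : s ∈ Set.Iic t) =>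
      MeasurableSpace.comap (fun ω : Path T => ω s) (borel ℝ)) s hst le_rfl)
      (le_univCompletion _)
  rw [measurable_iff_comap_le, BorelSpace.measurable_eq (α := ℝ)]
  exact h

theorem measurable_capAt {τ : Path T → WithTop (Set.Icc (0 : ℝ) T)}
    (hτ : IsStoppingTime (pathFiltration T) τ) (t : Set.Icc (0 : ℝ) T) :
    Measurable[pathFiltration T t] (fun ω => capAt (τ ω) t) := by
  let _ : MeasurableSpace (Path T) := pathFiltration T t
  refine measurable_of_Iic fun a => ?_
  rcases le_or_gt t a with hta | hat
  · convert MeasurableSet.univ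
    exact Set.eq_univ_of_forall fun ω => (capAt_le _ _).trans hta
  · convert (pathFiltration T).mono hat.le _ (hτ a) using 1
    ext ω
    change capAt (τ ω) t ≤ a ↔ τ ω ≤ a
    rcases h : τ ω with _ | b
    · change min t t ≤ a ↔ (⊤ : WithTop (Set.Icc (0 : ℝ) T)) ≤ (a : WithTop (Set.Icc (0 : ℝ) T))
      rw [min_self, top_le_iff]
      exact iff_of_false (not_le.2 hat) (WithTop.coe_ne_top)
    · have : capAt (WithTop.some b) t = min b t := rfl
      change capAt (WithTop.some b) t ≤ a ↔ (WithTop.some b) ≤ WithTop.some a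
      rw [this, WithTop.coe_le_coe, min_le_iff]
      exact or_iff_left (not_le.2 hat)

/-- By right-continuity, `ω ↦ ω(σ(ω))` is `𝓕_t`-measurable for `𝓕_t`-measurable `σ ≤ t`. -/
theorem measurable_eval {t : Set.Icc (0 : ℝ) T} {σ : Path T → Set.Icc (0 : ℝ) T}
    (hσ : Measurable[pathFiltration T t] σ) (hle : ∀ ω, σ ω ≤ t) :
    Measurable[pathFiltration T t] (fun ω => ω (σ ω)) := by
  let _ : MeasurableSpace (Path T) := pathFiltration T t
  have hmem : ∀ (n k : ℕ), min ((k : ℝ) / (n + 1)) t ∈ Set.Icc (0 : ℝ) T := fun n k =>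
    ⟨le_min (by positivity) t.2.1, (min_le_right _ _).trans t.2.2⟩
  let e : ℕ → ℕ → Set.Icc (0 : ℝ) T := fun n k => ⟨_, hmem n k⟩
  let κ : ℕ → Path T → ℕ := fun n ω => ⌈((n : ℝ) + 1) * (σ ω : ℝ)⌉₊
  have hκ : ∀ n, Measurable (κ n) := fun n =>
    Nat.measurable_ceil.comp ((measurable_subtype_coe.comp hσ).const_mul _)
  have hge : ∀ n ω, σ ω ≤ e n (κ n ω) := fun n ω => by
    refine Subtype.coe_le_coe.1 (le_min ?_ (hle ω))
    rw [le_div_iff₀ (by positivity), mul_comm]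
    exact Nat.le_ceil _
  have hub : ∀ n ω, (e n (κ n ω) : ℝ) ≤ σ ω + 1 / ((n : ℝ) + 1) := fun n ω => by
    refine (min_le_left _ _).trans ?_
    rw [div_le_iff₀ (by positivity), add_mul, one_div_mul_cancel (by positivity), mul_comm]
    exact (Nat.ceil_lt_add_one (mul_nonneg (by positivity) (σ ω).2.1)).le
  refine measurable_of_tendsto_metrizable (f := fun n ω => ω (e n (κ n ω))) (fun n => ?_) ?_
  · have h1 : Measurable (fun p : ℕ × Path T => p.2 (e n p.1)) :=
      measurable_from_prod_countable_right fun k =>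
        measurable_coord (s := e n k) (Subtype.coe_le_coe.1 (min_le_right _ _))
    exact h1.comp ((hκ n).prodMk measurable_id)
  · refine tendsto_pi_nhds.2 fun ω => ?_
    have h2 : Tendsto (fun n => e n (κ n ω)) atTop (𝓝 (σ ω)) := by
      refine tendsto_subtype_rng.2 (tendsto_of_tendsto_of_tendsto_of_le_of_le tendsto_const_nhds
        ?_ (fun n => Subtype.coe_le_coe.2 (hge n ω)) (fun n => hub n ω))
      simpa using tendsto_const_nhds.add (tendsto_one_div_add_atTop_nhds_zero_nat (𝕜 := ℝ))
    exact (ω.2.2 (σ ω)).tendsto.comp (tendsto_nhdsWithin_iff.2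
      ⟨h2, Eventually.of_forall fun n => hge n ω⟩)

/-- Simple capital processes are adapted. -/
theorem SimpleStrategy.measurable_capital (G : SimpleStrategy T) (t : Set.Icc (0 : ℝ) T) :
    Measurable[pathFiltration T t] (G.capital t) := by
  let _ : MeasurableSpace (Path T) := pathFiltration T t
  let g : ℕ → Path T → ℝ := fun n ω =>
    G.h n ω * (ω (capAt (G.τ (n + 1) ω) t) - ω (capAt (G.τ n ω) t))
  have hev : ∀ n, Measurable (fun ω : Path T => ω (capAt (G.τ n ω) t)) := fun n =>
    measurable_eval (measurable_capAt (G.isStoppingTime n) t) fun _ => capAt_le _ _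
  have hg : ∀ n, Measurable (g n) := fun n => by
    have hA : MeasurableSet {ω | G.τ n ω ≤ t} := G.isStoppingTime n t
    have hind : Measurable ({ω | G.τ n ω ≤ t}.indicator (G.h n)) := by
      intro B hB
      classical
      rw [Set.indicator_preimage, Set.ite]
      exact ((G.measurable n hB).2 t).union ((measurable_const hB).diff hA)
    have : g n = fun ω => {ω | G.τ n ω ≤ t}.indicator (G.h n) ω *
        (ω (capAt (G.τ (n + 1) ω) t) - ω (capAt (G.τ n ω) t)) := by
      funext ω
      by_cases hω : G.τ n ω ≤ t
      · rw [Set.indicator_of_mem (show ω ∈ {ω | G.τ n ω ≤ t} from hω)]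
      · rw [Set.indicator_of_notMem (show ω ∉ {ω | G.τ n ω ≤ t} from hω)]
        have hcap : ∀ a : WithTop (Set.Icc (0 : ℝ) T), t < a → capAt a t = t := by
          intro a ha
          rcases a with _ | b
          · exact min_self t
          · exact min_eq_right (WithTop.coe_lt_coe.1 ha).le
        have h1 := not_le.1 hω
        simp [g, hcap _ h1, hcap _ (h1.trans_le (G.mono n ω))]
    rw [this]
    exact hind.mul ((hev (n + 1)).sub (hev n))
  refine Measurable.const_add ?_ _
  refine measurable_of_tendsto_metrizable (f := fun N ω => ∑ n ∈ Finset.range N, g n ω)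
    (fun N => Finset.measurable_sum _ fun n _ => hg n) (tendsto_pi_nhds.2 fun ω => ?_)
  have hfin : (Function.support fun n => g n ω).Finite := G.finite_support t ω
  rw [← tsum_eq_finsum (L := SummationFilter.unconditional ℕ) hfin]
  exact (summable_of_hasFiniteSupport hfin).hasSum.tendsto_sum_nat

end RCPath

end

/-!
For `p > 2`, the `p`-variation of a path bounded by `L` is controlled by its upcrossings. An
increment of size comparable to `L / 2 ^ k` crosses one of the `2 ^ k` cells of size `L / 2 ^ k` of
`[0, L]`, up or down, and downcrossings of a cell alternate with upcrossings. So if the cells at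
scale `k` have at most about `4 ^ k` upcrossings in total, up to a factor polynomial in `k`, then
the `p`-variation is at most of order `∑ 4 ^ k * 2 ^ (-k * p) * poly k < ∞`
(`pVariation_lt_top_of_upcrossings_le`).

Upcrossings are bounded by trading. Buying at a price of at most `a` and selling at a price of at
least `b` earns `b - a` per upcrossing of `[a, b]`, and as prices are nonnegative, the initial
capital `a` covers every open position (`le_upcrossingStrategy_capital`). So the number of
upcrossings of `[a, b]`, truncated at any level, is superhedged at cost `a / (b - a)`
(`superhedge_upcrossings`). For the `j`-th cell at scale `k` this cost is `j`, hence at most `4 ^ k`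
in total over the `2 ^ k` cells. With the weights `4 ^ (-k) * (k + 1) ^ (-2)`, the sum over all
scales has finite cost; adding payoffs that are infinite on unbounded paths and summing over
`L = 1, 2, …` gives one payoff of finite cost (`variationPayoff`) that is infinite on all paths of
variation index above `2`. Such a payoff yields a positive capital process (`Superhedge.isNull`).

The times at which these strategies trade are successive entrance times of right-continuous paths
into closed sets. They are stopping times for the universally completed filtration because
`{τ ≤ t}` is the projection of a set that is Borel in the trading times and in the values of the
path at countably many times (`measurableSet_visits`), and analytic sets are universally measurable
(`AnalyticSet.nullMeasurableSet`).
-/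

noncomputable section

/-! ### Analytic sets are universally measurable -/

/-- The key step of Choquet's capacitability argument: the outer measure of a continuous image of
Baire space can be approximated from below by images of compact boxes `∏ [0, b n]`. -/
theorem exists_isCompact_subset_range_of_lt_measure {Y : Type*} [MetricSpace Y]
    [MeasurableSpace Y] [BorelSpace Y] (μ : Measure Y) [IsFiniteMeasure μ] {f : (ℕ → ℕ) → Y}
    (hf : Continuous f) {c : ℝ≥0∞} (hc : c < μ (Set.range f)) :
    ∃ K ⊆ Set.range f, IsCompact K ∧ c ≤ μ K := by
  -- Bounding one more coordinate keeps the outer measure of the image above `c`: outer measures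
  -- are continuous along increasing unions, even of nonmeasurable sets.
  have step : ∀ (n : ℕ) (S : Set (ℕ → ℕ)), ∃ m : ℕ, c < μ (f '' S) →
      c < μ (f '' (S ∩ {x | x n ≤ m})) := by
    intro n S
    by_cases h : c < μ (f '' S)
    · have hmono : Monotone fun m : ℕ => f '' (S ∩ {x | x n ≤ m}) := fun m m' hm =>
        Set.image_mono (Set.inter_subset_inter_right _ fun x (hx : x n ≤ m) => hx.trans hm)
      have hU : f '' S = ⋃ m : ℕ, f '' (S ∩ {x | x n ≤ m}) := by
        rw [← Set.image_iUnion, ← Set.inter_iUnion]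
        congr 1
        exact (Set.inter_eq_left.2 fun x _ =>
          Set.mem_iUnion.2 ⟨x n, show x n ≤ x n from le_rfl⟩).symm
      rw [hU, hmono.measure_iUnion, lt_iSup_iff] at h
      obtain ⟨m, hm⟩ := h
      exact ⟨m, fun _ => hm⟩
    · exact ⟨0, fun h' => absurd h' h⟩
  choose g hg using step
  let S : ℕ → Set (ℕ → ℕ) := fun n => Nat.rec Set.univ (fun n S => S ∩ {x | x n ≤ g n S}) n
  let b : ℕ → ℕ := fun n => g n (S n)
  have hS1 : ∀ n, S (n + 1) = S n ∩ {x | x n ≤ b n} := fun n => rfl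
  have hlt : ∀ n, c < μ (f '' S n) := by
    intro n
    induction n with
    | zero => simpa [S] using hc
    | succ n ih => exact hg n (S n) ih
  have hanti : Antitone S := antitone_nat_of_succ_le fun n => by
    rw [hS1]
    exact Set.inter_subset_left
  have hSle : ∀ {n i x}, x ∈ S n → i < n → x i ≤ b i := by
    intro n i x hx hi
    have := hanti (Nat.succ_le_of_lt hi) hx
    rw [Nat.succ_eq_add_one, hS1] at this
    exact this.2
  let K : Set (ℕ → ℕ) := Set.univ.pi fun i => Set.Iic (b i)
  have hK : IsCompact K := isCompact_univ_pi fun i => (Set.finite_Iic (b i)).isCompact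
  refine ⟨f '' K, Set.image_subset_range _ _, hK.image hf, ?_⟩
  -- A point in every `closure (f '' S n)` is a limit of values `f (x n)`; the truncations of the
  -- `x n` to the box `K` have a cluster point, which is also one of the `x n` themselves.
  have hsub : ⋂ n, closure (f '' S n) ⊆ f '' K := by
    intro y hy
    have hx : ∀ n : ℕ, ∃ x ∈ S n, dist y (f x) < 1 / ((n : ℝ) + 1) := by
      intro n
      obtain ⟨_, ⟨x, hx, rfl⟩, hd⟩ := Metric.mem_closure_iff.1 (Set.mem_iInter.1 hy n)
        (1 / ((n : ℝ) + 1)) (by positivity)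
      exact ⟨x, hx, hd⟩
    choose x hxS hxd using hx
    obtain ⟨z, hz, φ, hφ, hlim⟩ := hK.tendsto_subseq (x := fun n i => min (x n i) (b i))
      fun n i _ => show min (x n i) (b i) ≤ b i from min_le_right _ _
    have hlim' : Tendsto (fun k => x (φ k)) atTop (𝓝 z) := by
      refine tendsto_pi_nhds.2 fun i => (tendsto_pi_nhds.1 hlim i).congr' ?_
      filter_upwards [hφ.tendsto_atTop.eventually_gt_atTop i] with k hk
      exact min_eq_left (hSle (hxS (φ k)) hk)
    have hy' : Tendsto (fun n => f (x n)) atTop (𝓝 y) := by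
      rw [tendsto_iff_dist_tendsto_zero]
      refine squeeze_zero (fun _ => dist_nonneg) (fun n => ?_)
        (tendsto_one_div_add_atTop_nhds_zero_nat (𝕜 := ℝ))
      rw [dist_comm]
      exact (hxd n).le
    exact ⟨z, hz, tendsto_nhds_unique ((hf.tendsto z).comp hlim')
      (hy'.comp hφ.tendsto_atTop)⟩
  have hlim := tendsto_measure_iInter_atTop (μ := μ) (s := fun n => closure (f '' S n))
    (fun n => isClosed_closure.measurableSet.nullMeasurableSet)
    (fun m n hmn => closure_mono (Set.image_mono (hanti hmn))) ⟨0, measure_ne_top _ _⟩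
  exact (ge_of_tendsto' hlim fun n => (hlt n).le.trans (measure_mono subset_closure)).trans
    (measure_mono hsub)

/-- Analytic sets in Polish spaces are universally measurable. -/
theorem MeasureTheory.AnalyticSet.nullMeasurableSet {Y : Type*} [TopologicalSpace Y]
    [PolishSpace Y] [MeasurableSpace Y] [BorelSpace Y] {s : Set Y} (hs : AnalyticSet s)
    (μ : Measure Y) [IsFiniteMeasure μ] : NullMeasurableSet s μ := by
  let _ := TopologicalSpace.metrizableSpaceMetric Y
  rw [AnalyticSet] at hs
  rcases hs with rfl | ⟨f, hf, rfl⟩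
  · exact nullMeasurableSet_empty
  rcases eq_or_ne (μ (Set.range f)) 0 with h0 | h0
  · exact NullMeasurableSet.of_null h0
  obtain ⟨c, -, hc, hlim⟩ := exists_seq_strictMono_tendsto' (pos_iff_ne_zero.2 h0)
  choose K hKs hKc hK using fun n => exists_isCompact_subset_range_of_lt_measure μ hf (hc n).2
  have hB : MeasurableSet (⋃ n, K n) := MeasurableSet.iUnion fun n => (hKc n).measurableSet
  have hBs : ⋃ n, K n ⊆ Set.range f := Set.iUnion_subset hKs
  have hle : μ (Set.range f) ≤ μ (⋃ n, K n) :=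
    le_of_tendsto' hlim fun n => (hK n).trans (measure_mono (Set.subset_iUnion K n))
  refine hB.nullMeasurableSet.congr ?_
  exact ae_eq_of_subset_of_measure_ge hBs hle hB.nullMeasurableSet (measure_ne_top _ _)

namespace RCPath

variable {T : ℝ}

/-! ### Successive visits to closed sets -/

/-- The path `ω` visits `F 0, …, F (n - 1)` in this order (at weakly increasing times) by
time `t`. -/
def Visits (F : ℕ → Set ℝ) : ℕ → Set.Icc (0 : ℝ) T → Path T → Prop
  | 0, _, _ => True
  | n + 1, t, ω => ∃ s ≤ t, Visits F n s ω ∧ ω s ∈ F n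

theorem Visits.mono_time {F : ℕ → Set ℝ} {n : ℕ} {s t : Set.Icc (0 : ℝ) T} {ω : Path T}
    (hst : s ≤ t) (h : Visits F n s ω) : Visits F n t ω := by
  cases n with
  | zero => trivial
  | succ n =>
    obtain ⟨r, hr, h⟩ := h
    exact ⟨r, hr.trans hst, h⟩

theorem Visits.of_succ {F : ℕ → Set ℝ} {n : ℕ} {t : Set.Icc (0 : ℝ) T} {ω : Path T}
    (h : Visits F (n + 1) t ω) : Visits F n t ω := by
  obtain ⟨s, hs, h, -⟩ := h
  exact h.mono_time hs

theorem Visits.anti {F : ℕ → Set ℝ} {m n : ℕ} {t : Set.Icc (0 : ℝ) T} {ω : Path T}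
    (hmn : m ≤ n) (h : Visits F n t ω) : Visits F m t ω := by
  induction n, hmn using Nat.le_induction with
  | base => exact h
  | succ n _ ih => exact ih h.of_succ

theorem Visits.snoc {F : ℕ → Set ℝ} {n : ℕ} {t : Set.Icc (0 : ℝ) T} {ω : Path T}
    (h : Visits F n t ω) (ht : ω t ∈ F n) : Visits F (n + 1) t ω :=
  ⟨t, le_rfl, h, ht⟩

/-- By right-continuity, the set of times after `t₀` at which a path is in a closed set contains
its infimum. -/
theorem exists_isLeast_mem {F : Set ℝ} (hF : IsClosed F) (ω : Path T) (t₀ : Set.Icc (0 : ℝ) T)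
    (h : ∃ s, t₀ ≤ s ∧ ω s ∈ F) : ∃ s, IsLeast {s | t₀ ≤ s ∧ ω s ∈ F} s := by
  let S : Set ℝ := Subtype.val '' {s | t₀ ≤ s ∧ ω s ∈ F}
  have hne : S.Nonempty := by
    obtain ⟨s, hs⟩ := h
    exact ⟨s, s, hs, rfl⟩
  have hbd : ∀ x ∈ S, (t₀ : ℝ) ≤ x := by
    rintro _ ⟨s, hs, rfl⟩
    exact hs.1
  have hbdd : BddBelow S := ⟨t₀, hbd⟩
  have hle : ∀ s, t₀ ≤ s → ω s ∈ F → sInf S ≤ s := fun s h1 h2 => csInf_le hbdd ⟨s, ⟨h1, h2⟩, rfl⟩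
  have ht₀ : (t₀ : ℝ) ≤ sInf S := le_csInf hne hbd
  have hmem : sInf S ∈ Set.Icc (0 : ℝ) T := by
    obtain ⟨_, ⟨s, hs, rfl⟩⟩ := id hne
    exact ⟨t₀.2.1.trans ht₀, (hle s hs.1 hs.2).trans s.2.2⟩
  obtain ⟨u, -, hu, huS⟩ := exists_seq_tendsto_sInf hne hbdd
  choose v hv hvu using huS
  let x : Set.Icc (0 : ℝ) T := ⟨sInf S, hmem⟩
  refine ⟨x, ⟨ht₀, ?_⟩, fun s hs => hle s hs.1 hs.2⟩
  have hvx : Tendsto v atTop (𝓝 x) := by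
    refine tendsto_subtype_rng.2 ?_
    simpa only [hvu] using hu
  refine hF.mem_of_tendsto ((ω.2.2 x).tendsto.comp (tendsto_nhdsWithin_iff.2
    ⟨hvx, Eventually.of_forall fun n => ?_⟩)) (Eventually.of_forall fun n => (hv n).2)
  exact hle _ (hv n).1 (hv n).2

/-- The earliest completion time exists: it is found greedily, visiting each set as early as
possible. -/
theorem exists_isLeast_visits {F : ℕ → Set ℝ} (hF : ∀ n, IsClosed (F n)) (ω : Path T) (n : ℕ)
    (h : ∃ t, Visits F n t ω) : ∃ t, IsLeast {t | Visits F n t ω} t := by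
  induction n with
  | zero =>
    obtain ⟨t, -⟩ := h
    exact ⟨⟨0, le_rfl, t.2.1.trans t.2.2⟩, trivial, fun s _ => s.2.1⟩
  | succ n ih =>
    obtain ⟨t, s, hst, hs, hsF⟩ := h
    obtain ⟨t₀, ht₀, hmin⟩ := ih ⟨s, hs⟩
    obtain ⟨u, hu, humin⟩ := exists_isLeast_mem (hF n) ω t₀ ⟨s, hmin hs, hsF⟩
    refine ⟨u, ⟨u, le_rfl, ht₀.mono_time hu.1, hu.2⟩, ?_⟩
    rintro r ⟨q, hq, hqv, hqF⟩
    exact (humin ⟨hmin hqv, hqF⟩).trans hq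

/-- The times of the visits can be chosen at once. -/
theorem visits_iff_exists_times {F : ℕ → Set ℝ} {n : ℕ} {t : Set.Icc (0 : ℝ) T} {ω : Path T} :
    Visits F n t ω ↔ ∃ s : ℕ → Set.Icc (0 : ℝ) T,
      (∀ i < n, s i ≤ t) ∧ (∀ i, i + 1 < n → s i ≤ s (i + 1)) ∧ ∀ i < n, ω (s i) ∈ F i := by
  induction n generalizing t with
  | zero => exact ⟨fun _ => ⟨fun _ => t, by simp⟩, fun _ => trivial⟩
  | succ n ih =>
    constructor
    · rintro ⟨r, hr, hv, hF⟩
      obtain ⟨s, h1, h2, h3⟩ := ih.1 hv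
      refine ⟨fun i => if i < n then s i else r, fun i hi => ?_, fun i hi => ?_, fun i hi => ?_⟩
      · dsimp only
        split_ifs with h
        · exact (h1 i h).trans hr
        · exact hr
      · have hi' : i < n := by omega
        simp only [hi', if_true]
        split_ifs with h
        · exact h2 i h
        · exact h1 i hi'
      · dsimp only
        split_ifs with h
        · exact h3 i h
        · obtain rfl : i = n := by omega
          exact hF
    · rintro ⟨s, h1, h2, h3⟩
      refine ⟨s n, h1 n (by omega), ih.2 ⟨s, ?_, fun i hi => h2 i (by omega),
        fun i hi => h3 i (by omega)⟩, h3 n (by omega)⟩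
      have key : ∀ k i, i + k = n → s i ≤ s n := by
        intro k
        induction k with
        | zero =>
          rintro i rfl
          exact le_rfl
        | succ k ihk =>
          intro i hik
          exact (h2 i (by omega)).trans (ihk (i + 1) (by omega))
      exact fun i hi => key (n - i) i (by omega)

/-! ### Measurability of visits -/

/-- The point `k / (n + 1)` of a uniform grid, truncated at `t`. -/
def gridPoint (t : Set.Icc (0 : ℝ) T) (n k : ℕ) : Set.Icc (0 : ℝ) T :=
  ⟨min ((k : ℝ) / (n + 1)) t, le_min (by positivity) t.2.1, (min_le_right _ _).trans t.2.2⟩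

/-- A path before `t` is recovered from its values at the grid points, approaching each time from
the right. -/
theorem tendsto_gridPoint (ω : Path T) {s t : Set.Icc (0 : ℝ) T} (hst : s ≤ t) :
    Tendsto (fun n : ℕ => ω (gridPoint t n ⌈((n : ℝ) + 1) * (s : ℝ)⌉₊)) atTop (𝓝 (ω s)) := by
  have hge : ∀ n : ℕ, s ≤ gridPoint t n ⌈((n : ℝ) + 1) * (s : ℝ)⌉₊ := fun n => by
    refine Subtype.coe_le_coe.1 (le_min ?_ hst)
    rw [le_div_iff₀ (by positivity), mul_comm]
    exact Nat.le_ceil _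
  have hub : ∀ n : ℕ,
      (gridPoint t n ⌈((n : ℝ) + 1) * (s : ℝ)⌉₊ : ℝ) ≤ s + 1 / ((n : ℝ) + 1) := fun n => by
    refine (min_le_left _ _).trans ?_
    rw [div_le_iff₀ (by positivity), add_mul _ _ ((n : ℝ) + 1), one_div_mul_cancel (by positivity),
      mul_comm (s : ℝ)]
    exact (Nat.ceil_lt_add_one (mul_nonneg (by positivity) s.2.1)).le
  have h : Tendsto (fun n : ℕ => gridPoint t n ⌈((n : ℝ) + 1) * (s : ℝ)⌉₊) atTop (𝓝 s) := by
    refine tendsto_subtype_rng.2 (tendsto_of_tendsto_of_tendsto_of_le_of_le tendsto_const_nhds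
      ?_ (fun n => Subtype.coe_le_coe.2 (hge n)) hub)
    simpa using tendsto_const_nhds.add (tendsto_one_div_add_atTop_nhds_zero_nat (𝕜 := ℝ))
  exact (ω.2.2 s).tendsto.comp (tendsto_nhdsWithin_iff.2 ⟨h, Eventually.of_forall hge⟩)

/-- Visiting closed sets by time `t` is an event of `𝓕_t`: expressed through the values of the path
on a countable set of times, it is the projection of a Borel set, hence the preimage of an analytic
set. -/
theorem measurableSet_visits {F : ℕ → Set ℝ} (hF : ∀ n, IsClosed (F n)) (n : ℕ)
    (t : Set.Icc (0 : ℝ) T) : MeasurableSet[pathFiltration T t] {ω | Visits F n t ω} := by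
  have : PolishSpace (Set.Icc (0 : ℝ) T) := isClosed_Icc.polishSpace
  let φ : Path T → ℕ × ℕ → ℝ := fun ω p => ω (gridPoint t p.1 p.2)
  have hφ : Measurable[rawSigma T t] φ := by
    let _ : MeasurableSpace (Path T) := rawSigma T t
    refine measurable_pi_lambda _ fun p => ?_
    rw [measurable_iff_comap_le, BorelSpace.measurable_eq (α := ℝ)]
    exact le_iSup₂_of_le (f := fun (s : Set.Icc (0 : ℝ) T) (_ : s ∈ Set.Iic t) =>
      MeasurableSpace.comap (fun ω : Path T => ω s) (borel ℝ)) (gridPoint t p.1 p.2)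
      (show gridPoint t p.1 p.2 ≤ t from Subtype.coe_le_coe.1 (min_le_right _ _)) le_rfl
  -- The condition `ω (s i) ∈ F i` is expressed by the distances to `F i` along the grid points.
  let g : ℕ → ℕ → (ℕ → Set.Icc (0 : ℝ) T) × (ℕ × ℕ → ℝ) → ℝ≥0∞ := fun i m p =>
    Metric.infEDist (p.2 (m, ⌈((m : ℝ) + 1) * (p.1 i : ℝ)⌉₊)) (F i)
  let B : Set ((ℕ → Set.Icc (0 : ℝ) T) × (ℕ × ℕ → ℝ)) :=
    (⋂ i, ⋂ _ : i < n, {p | p.1 i ≤ t}) ∩ (⋂ i, ⋂ _ : i + 1 < n, {p | p.1 i ≤ p.1 (i + 1)}) ∩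
      ⋂ i, ⋂ _ : i < n, {p | Tendsto (fun m => g i m p) atTop (𝓝 0)}
  have hcoord : ∀ i, Measurable fun p : (ℕ → Set.Icc (0 : ℝ) T) × (ℕ × ℕ → ℝ) => p.1 i :=
    fun i => (measurable_pi_apply i).comp measurable_fst
  have hg : ∀ i m, Measurable (g i m) := by
    intro i m
    have h1 : Measurable fun q : ℕ × (ℕ × ℕ → ℝ) => q.2 (m, q.1) :=
      measurable_from_prod_countable_right fun k => measurable_pi_apply (m, k)
    have h2 : Measurable fun p : (ℕ → Set.Icc (0 : ℝ) T) × (ℕ × ℕ → ℝ) =>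
        ⌈((m : ℝ) + 1) * (p.1 i : ℝ)⌉₊ :=
      Nat.measurable_ceil.comp ((measurable_subtype_coe.comp (hcoord i)).const_mul _)
    exact Metric.continuous_infEDist.measurable.comp (h1.comp (h2.prodMk measurable_snd))
  have hB : MeasurableSet B := by
    refine MeasurableSet.inter (MeasurableSet.inter ?_ ?_) ?_
    · exact .iInter fun i => .iInter fun _ => measurableSet_le (hcoord i) measurable_const
    · exact .iInter fun i => .iInter fun _ => measurableSet_le (hcoord i) (hcoord (i + 1))
    · exact .iInter fun i => .iInter fun _ => measurableSet_tendsto _ (hg i)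
  have hBmem : ∀ p, p ∈ B ↔ (∀ i < n, p.1 i ≤ t) ∧ (∀ i, i + 1 < n → p.1 i ≤ p.1 (i + 1)) ∧
      ∀ i < n, Tendsto (fun m => g i m p) atTop (𝓝 0) := fun p => by
    simp only [B, Set.mem_inter_iff, Set.mem_iInter, Set.mem_ofPred_eq, and_assoc]
  have hpre : {ω | Visits F n t ω} = φ ⁻¹' (Prod.snd '' B) := by
    ext ω
    have hmem : ∀ {s : ℕ → Set.Icc (0 : ℝ) T} {i : ℕ}, s i ≤ t →
        (ω (s i) ∈ F i ↔ Tendsto (fun m => g i m (s, φ ω)) atTop (𝓝 0)) := by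
      intro s i hi
      have hlim : Tendsto (fun m => g i m (s, φ ω)) atTop (𝓝 (Metric.infEDist (ω (s i)) (F i))) :=
        (Metric.continuous_infEDist.tendsto _).comp (tendsto_gridPoint ω hi)
      rw [Metric.mem_iff_infEDist_zero_of_closed (hF i)]
      exact ⟨fun h => h ▸ hlim, fun h => tendsto_nhds_unique hlim h⟩
    change Visits F n t ω ↔ φ ω ∈ Prod.snd '' B
    rw [visits_iff_exists_times]
    constructor
    · rintro ⟨s, h1, h2, h3⟩
      exact ⟨(s, φ ω), (hBmem _).2 ⟨h1, h2, fun i hi => (hmem (h1 i hi)).1 (h3 i hi)⟩, rfl⟩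
    · rintro ⟨⟨s, x⟩, hp, rfl⟩
      obtain ⟨h1, h2, h3⟩ := (hBmem _).1 hp
      exact ⟨s, h1, h2, fun i hi => (hmem (h1 i hi)).2 (h3 i hi)⟩
  have hana : AnalyticSet (Prod.snd '' B) := hB.analyticSet_image measurable_snd
  rw [hpre]
  -- Under the image of a given measure on paths, the analytic set is null measurable.
  intro μ hμ
  let _ : MeasurableSpace (Path T) := rawSigma T t
  exact (hana.nullMeasurableSet (μ.map φ)).preimage (hφ.quasiMeasurePreserving μ)

/-! ### The times of the visits -/

open Classical in
/-- The time of the `n`-th of the successive visits, `⊤` if it does not happen. -/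
def visitTime (F : ℕ → Set ℝ) (n : ℕ) (ω : Path T) : WithTop (Set.Icc (0 : ℝ) T) :=
  if h : ∃ t, IsLeast {t | Visits F n t ω} t then h.choose else ⊤

theorem visitTime_le_iff {F : ℕ → Set ℝ} (hF : ∀ n, IsClosed (F n)) {n : ℕ} {ω : Path T}
    {t : Set.Icc (0 : ℝ) T} : visitTime F n ω ≤ t ↔ Visits F n t ω := by
  unfold visitTime
  split_ifs with h
  · rw [WithTop.coe_le_coe]
    exact ⟨fun hle => Visits.mono_time hle h.choose_spec.1, fun hv => h.choose_spec.2 hv⟩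
  · exact iff_of_false (by simp) fun hv => h (exists_isLeast_visits hF ω n ⟨t, hv⟩)

theorem visitTime_mono {F : ℕ → Set ℝ} (hF : ∀ n, IsClosed (F n)) (ω : Path T) :
    Monotone fun n => visitTime F n ω := by
  refine monotone_nat_of_le_succ fun n => ?_
  rcases h : visitTime F (n + 1) ω with _ | t
  · exact le_top
  · exact (visitTime_le_iff hF).2 ((visitTime_le_iff hF).1 h.le).of_succ

theorem mem_of_visitTime_eq {F : ℕ → Set ℝ} (hF : ∀ n, IsClosed (F n)) {n : ℕ} {ω : Path T}
    {t : Set.Icc (0 : ℝ) T} (h : visitTime F (n + 1) ω = t) : ω t ∈ F n := by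
  obtain ⟨s, hst, hs, hsF⟩ := (visitTime_le_iff hF).1 h.le
  have hts : (t : WithTop (Set.Icc (0 : ℝ) T)) ≤ s :=
    h ▸ (visitTime_le_iff hF).2 (hs.snoc hsF)
  rwa [le_antisymm (WithTop.coe_le_coe.1 hts) hst]

theorem isStoppingTime_visitTime {F : ℕ → Set ℝ} (hF : ∀ n, IsClosed (F n)) (n : ℕ) :
    IsStoppingTime (pathFiltration T) (visitTime F n) := by
  intro t
  simp only [visitTime_le_iff hF]
  exact measurableSet_visits hF n t

/-! ### Trading on upcrossings -/

/-- The sets `(-∞, a], [b, ∞), (-∞, a], …`, whose successive visits are the upcrossings of `[a, b]`: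
`m` upcrossings are completed by time `t` iff `Visits (crossSets a b) (2 * m) t ω`. -/
def crossSets (a b : ℝ) (n : ℕ) : Set ℝ :=
  if Even n then Set.Iic a else Set.Ici b

theorem isClosed_crossSets (a b : ℝ) (n : ℕ) : IsClosed (crossSets a b n) := by
  unfold crossSets
  split_ifs
  · exact isClosed_Iic
  · exact isClosed_Ici

theorem crossSets_two_mul (a b : ℝ) (m : ℕ) : crossSets a b (2 * m) = Set.Iic a := by
  simp [crossSets]

theorem crossSets_two_mul_add_one (a b : ℝ) (m : ℕ) :
    crossSets a b (2 * m + 1) = Set.Ici b := by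
  simp [crossSets]

/-- Starting with capital `a`, buy one share whenever the price falls to `a`, sell it when the price
rises to `b`, and stop after `M` such round trips. The time of visit number `0` is `0` and
precedes the first purchase, so a share is held between the visits `n` and `n + 1` for odd `n`. -/
def upcrossingStrategy (a b : ℝ) (M : ℕ) : SimpleStrategy T where
  c := a
  τ n ω := if n ≤ 2 * M then visitTime (crossSets a b) n ω else ⊤
  isStoppingTime n := by
    split_ifs
    · exact isStoppingTime_visitTime (isClosed_crossSets a b) n
    · intro t
      simp
  mono n ω := by
    split_ifs with h1 h2
    · exact visitTime_mono (isClosed_crossSets a b) ω n.le_succ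
    · exact le_top
    · omega
    · exact le_rfl
  finite ω := (Set.finite_Iic (2 * M)).subset fun n hn => by
    by_contra h
    exact hn (if_neg h)
  h n _ := if Odd n then 1 else 0
  bounded n := ⟨1, fun _ => by split_ifs <;> simp⟩
  measurable n := measurable_const

theorem capAt_of_not_le {τ : WithTop (Set.Icc (0 : ℝ) T)} {t : Set.Icc (0 : ℝ) T}
    (h : ¬ τ ≤ t) : capAt τ t = t := by
  rcases τ with _ | s
  · exact min_self t
  · exact min_eq_right (le_of_not_ge fun hs => h (WithTop.coe_le_coe.2 hs))

theorem coe_capAt_of_le {τ : WithTop (Set.Icc (0 : ℝ) T)} {t : Set.Icc (0 : ℝ) T}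
    (h : τ ≤ t) : τ = capAt τ t := by
  rcases τ with _ | s
  · exact absurd (top_le_iff.1 h) WithTop.coe_ne_top
  · exact congrArg WithTop.some (min_eq_left (WithTop.coe_le_coe.1 h)).symm

theorem SimpleStrategy.capital_zero (G : SimpleStrategy T) (h0 : (0 : ℝ) ∈ Set.Icc 0 T)
    (ω : Path T) : G.capital ⟨0, h0⟩ ω = G.c := by
  have h : ∀ τ, capAt τ (⟨0, h0⟩ : Set.Icc (0 : ℝ) T) = ⟨0, h0⟩ := fun τ =>
    le_antisymm (capAt_le _ _) (capAt τ _).2.1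
  simp [SimpleStrategy.capital, h]

theorem upcrossingStrategy_capital (a b : ℝ) (M : ℕ) (t : Set.Icc (0 : ℝ) T) (ω : Path T) :
    (upcrossingStrategy a b M).capital t ω = a + ∑ m ∈ Finset.range M,
      (ω (capAt (visitTime (crossSets a b) (2 * m + 2) ω) t) -
        ω (capAt (visitTime (crossSets a b) (2 * m + 1) ω) t)) := by
  let g : ℕ → ℝ := fun n => (if Odd n then 1 else 0) *
    (ω (capAt (if n + 1 ≤ 2 * M then visitTime (crossSets a b) (n + 1) ω else ⊤) t) -
      ω (capAt (if n ≤ 2 * M then visitTime (crossSets a b) n ω else ⊤) t))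
  -- For `n ≥ 2 * M` either the position or both stopping times make the term vanish; among the
  -- others only those with odd `n`, when a share is held, contribute.
  have hsupp : Function.support g ⊆ Finset.range (2 * M) := by
    intro n hn
    by_contra h
    have hn' : 2 * M ≤ n := by simpa using h
    apply hn
    rcases hn'.eq_or_lt with rfl | hlt
    · simp [g]
    · simp [g, show ¬ n < 2 * M by omega, show ¬ n ≤ 2 * M by omega]
  have hsum : ∀ N, ∑ n ∈ Finset.range (2 * N), g n = ∑ m ∈ Finset.range N, g (2 * m + 1) := by
    intro N
    induction N with
    | zero => simp
    | succ N ih =>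
      rw [mul_add, Finset.sum_range_succ, Finset.sum_range_succ, Finset.sum_range_succ, ih]
      simp [g]
  change a + ∑ᶠ n, g n = _
  rw [finsum_eq_sum_of_support_subset g hsupp, hsum]
  congr 1
  refine Finset.sum_congr rfl fun m hm => ?_
  have hm' := Finset.mem_range.1 hm
  simp [g, show 2 * m + 1 < 2 * M by omega, show 2 * m + 1 ≤ 2 * M by omega]

/-- Every completed upcrossing of `[a, b]` earns at least `b - a`, and an open position never loses
more than the initial capital `a`, since the price is nonnegative. -/
theorem le_upcrossingStrategy_capital {a b : ℝ} (ha : 0 ≤ a) (hab : a ≤ b) {M m : ℕ} (hm : m ≤ M)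
    {t : Set.Icc (0 : ℝ) T} {ω : Path T} (hv : Visits (crossSets a b) (2 * m) t ω) :
    m * (b - a) ≤ (upcrossingStrategy a b M).capital t ω := by
  have hF := isClosed_crossSets a b
  let X : ℕ → ℝ := fun n => ω (capAt (visitTime (crossSets a b) n ω) t)
  have hX1 : ∀ n, ¬ Visits (crossSets a b) n t ω → X n = ω t := fun n hn =>
    congrArg ω (capAt_of_not_le fun h => hn ((visitTime_le_iff hF).1 h))
  have hX2 : ∀ n, Visits (crossSets a b) (n + 1) t ω → X (n + 1) ∈ crossSets a b n := fun n hn =>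
    mem_of_visitTime_eq hF (coe_capAt_of_le ((visitTime_le_iff hF).2 hn))
  -- After the first `N` round trips either all are completed, or `k` of them are completed and the
  -- next one is open or not yet begun.
  have key : ∀ N, (Visits (crossSets a b) (2 * N) t ω ∧
      N * (b - a) ≤ ∑ m ∈ Finset.range N, (X (2 * m + 2) - X (2 * m + 1))) ∨
      (¬ Visits (crossSets a b) (2 * N) t ω ∧ ∃ k : ℕ, ¬ Visits (crossSets a b) (2 * k + 2) t ω ∧
        k * (b - a) - a ≤ ∑ m ∈ Finset.range N, (X (2 * m + 2) - X (2 * m + 1))) := by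
    intro N
    induction N with
    | zero => exact Or.inl ⟨trivial, by simp⟩
    | succ N ih =>
      rw [Finset.sum_range_succ, show 2 * (N + 1) = 2 * N + 2 by ring]
      by_cases h2 : Visits (crossSets a b) (2 * N + 2) t ω
      · left
        refine ⟨h2, ?_⟩
        rcases ih with ⟨-, ih⟩ | ⟨h, -⟩
        · have e2 := hX2 _ h2
          have e1 := hX2 _ h2.of_succ
          rw [crossSets_two_mul_add_one] at e2
          rw [crossSets_two_mul] at e1
          have e1' : X (2 * N + 1) ≤ a := e1
          have e2' : b ≤ X (2 * N + 2) := e2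
          push_cast
          linarith
        · exact absurd h2.of_succ.of_succ h
      · right
        refine ⟨h2, ?_⟩
        rcases ih with ⟨-, ih⟩ | ⟨h, k, hk, ih⟩
        · refine ⟨N, h2, ?_⟩
          rw [hX1 _ h2]
          by_cases h1 : Visits (crossSets a b) (2 * N + 1) t ω
          · have e1 := hX2 _ h1
            rw [crossSets_two_mul] at e1
            have e1' : X (2 * N + 1) ≤ a := e1
            have := ω.2.1 t
            linarith
          · rw [hX1 _ h1]
            linarith
        · refine ⟨k, hk, ?_⟩
          rw [hX1 _ h2, hX1 _ fun h' => h h'.of_succ]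
          linarith
  rw [upcrossingStrategy_capital]
  change _ ≤ a + ∑ m ∈ Finset.range M, (X (2 * m + 2) - X (2 * m + 1))
  have hba : 0 ≤ b - a := sub_nonneg.2 hab
  rcases key M with ⟨-, h⟩ | ⟨-, k, hk, h⟩
  · have : (m : ℝ) * (b - a) ≤ M * (b - a) :=
      mul_le_mul_of_nonneg_right (Nat.cast_le.2 hm) hba
    linarith
  · have hmk : m ≤ k := by
      by_contra hlt
      exact hk (hv.anti (by omega))
    have : (m : ℝ) * (b - a) ≤ k * (b - a) :=
      mul_le_mul_of_nonneg_right (Nat.cast_le.2 hmk) hba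
    linarith

theorem upcrossingStrategy_capital_nonneg {a b : ℝ} (ha : 0 ≤ a) (hab : a ≤ b) (M : ℕ)
    (t : Set.Icc (0 : ℝ) T) (ω : Path T) : 0 ≤ (upcrossingStrategy a b M).capital t ω := by
  simpa using
    le_upcrossingStrategy_capital ha hab (Nat.zero_le M) (m := 0) (t := t) (ω := ω) trivial

/-! ### Superhedging -/

/-- The strategy that keeps the constant capital `c`. -/
def constStrategy (c : ℝ) : SimpleStrategy T where
  c := c
  τ _ _ := ⊤
  isStoppingTime _ t := by simp
  mono _ _ := le_rfl
  finite ω := by simp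
  h _ _ := 0
  bounded _ := ⟨0, by simp⟩
  measurable _ := measurable_const

@[simp]
theorem constStrategy_capital (c : ℝ) (t : Set.Icc (0 : ℝ) T) (ω : Path T) :
    (constStrategy c).capital t ω = c := by
  simp [SimpleStrategy.capital, constStrategy]

/-- The strategy `G` with all its positions multiplied by `r`. -/
def SimpleStrategy.scale (r : ℝ) (G : SimpleStrategy T) : SimpleStrategy T where
  c := r * G.c
  τ := G.τ
  isStoppingTime := G.isStoppingTime
  mono := G.mono
  finite := G.finite
  h n ω := r * G.h n ω
  bounded n := by
    obtain ⟨C, hC⟩ := G.bounded n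
    refine ⟨|r| * C, fun ω => ?_⟩
    rw [abs_mul]
    exact mul_le_mul_of_nonneg_left (hC ω) (abs_nonneg r)
  measurable n := (G.measurable n).const_mul r

@[simp]
theorem SimpleStrategy.scale_capital (r : ℝ) (G : SimpleStrategy T) (t : Set.Icc (0 : ℝ) T)
    (ω : Path T) : (G.scale r).capital t ω = r * G.capital t ω := by
  simp only [SimpleStrategy.capital, SimpleStrategy.scale, mul_add, mul_assoc]
  exact congrArg _ (mul_finsum _ r).symm

/-- The payoff `f` at time `T` can be superhedged, with countably many strategies of nonnegative
capital, at total cost at most `C`. -/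
def Superhedge (hT : 0 ≤ T) (f : Path T → ℝ≥0∞) (C : ℝ≥0∞) : Prop :=
  ∃ G : ℕ → SimpleStrategy T, (∀ n t ω, 0 ≤ (G n).capital t ω) ∧
    ∑' n, ENNReal.ofReal (G n).c ≤ C ∧
    ∀ ω, f ω ≤ ∑' n, ENNReal.ofReal ((G n).capital ⟨T, Set.right_mem_Icc.2 hT⟩ ω)

variable {hT : 0 ≤ T}

theorem Superhedge.of_strategy {f : Path T → ℝ≥0∞} (G : SimpleStrategy T)
    (hG : ∀ t ω, 0 ≤ G.capital t ω)
    (hf : ∀ ω, f ω ≤ ENNReal.ofReal (G.capital ⟨T, Set.right_mem_Icc.2 hT⟩ ω)) :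
    Superhedge hT f (ENNReal.ofReal G.c) := by
  refine ⟨fun n => if n = 0 then G else constStrategy 0, fun n t ω => ?_, ?_, fun ω => ?_⟩
  · dsimp only
    split_ifs
    · exact hG t ω
    · simp
  · rw [tsum_eq_single 0 fun n hn => by simp [hn, constStrategy]]
    simp
  · rw [tsum_eq_single 0 fun n hn => by simp [hn]]
    simpa using hf ω

theorem Superhedge.mono {f g : Path T → ℝ≥0∞} {C D : ℝ≥0∞} (h : Superhedge hT f C)
    (hfg : ∀ ω, g ω ≤ f ω) (hCD : C ≤ D) : Superhedge hT g D := by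
  obtain ⟨G, h1, h2, h3⟩ := h
  exact ⟨G, h1, h2.trans hCD, fun ω => (hfg ω).trans (h3 ω)⟩

theorem Superhedge.const_mul {f : Path T → ℝ≥0∞} {C : ℝ≥0∞} (h : Superhedge hT f C) {r : ℝ}
    (hr : 0 ≤ r) :
    Superhedge hT (fun ω => ENNReal.ofReal r * f ω) (ENNReal.ofReal r * C) := by
  obtain ⟨G, h1, h2, h3⟩ := h
  refine ⟨fun n => (G n).scale r, fun n t ω => ?_, ?_, fun ω => ?_⟩
  · rw [SimpleStrategy.scale_capital]
    exact mul_nonneg hr (h1 n t ω)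
  · simp only [SimpleStrategy.scale, ENNReal.ofReal_mul hr, ENNReal.tsum_mul_left]
    gcongr
  · simp only [SimpleStrategy.scale_capital, ENNReal.ofReal_mul hr, ENNReal.tsum_mul_left]
    gcongr
    exact h3 ω

theorem Superhedge.tsum_nat {f : ℕ → Path T → ℝ≥0∞} {C : ℕ → ℝ≥0∞}
    (h : ∀ i, Superhedge hT (f i) (C i)) :
    Superhedge hT (fun ω => ∑' i, f i ω) (∑' i, C i) := by
  choose G h1 h2 h3 using h
  refine ⟨fun n => G n.unpair.1 n.unpair.2, fun n => h1 _ _, ?_, fun ω => ?_⟩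
  · calc ∑' n : ℕ, ENNReal.ofReal (G n.unpair.1 n.unpair.2).c
        = ∑' p : ℕ × ℕ, ENNReal.ofReal (G p.1 p.2).c :=
          Nat.pairEquiv.symm.tsum_eq fun p : ℕ × ℕ => ENNReal.ofReal (G p.1 p.2).c
      _ = ∑' i, ∑' j, ENNReal.ofReal (G i j).c :=
          ENNReal.tsum_prod (f := fun i j => ENNReal.ofReal (G i j).c)
      _ ≤ ∑' i, C i := ENNReal.tsum_le_tsum h2
  · let t : Set.Icc (0 : ℝ) T := ⟨T, Set.right_mem_Icc.2 hT⟩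
    calc ∑' i, f i ω ≤ ∑' i, ∑' j, ENNReal.ofReal ((G i j).capital t ω) :=
          ENNReal.tsum_le_tsum fun i => h3 i ω
      _ = ∑' p : ℕ × ℕ, ENNReal.ofReal ((G p.1 p.2).capital t ω) :=
          (ENNReal.tsum_prod (f := fun i j => ENNReal.ofReal ((G i j).capital t ω))).symm
      _ = _ := (Nat.pairEquiv.symm.tsum_eq
          fun p : ℕ × ℕ => ENNReal.ofReal ((G p.1 p.2).capital t ω)).symm

theorem Superhedge.zero : Superhedge hT (fun _ => 0) 0 :=
  ⟨fun _ => constStrategy 0, by simp, by simp [constStrategy], by simp⟩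

theorem Superhedge.add {f g : Path T → ℝ≥0∞} {C D : ℝ≥0∞} (hf : Superhedge hT f C)
    (hg : Superhedge hT g D) : Superhedge hT (fun ω => f ω + g ω) (C + D) := by
  have h := Superhedge.tsum_nat (hT := hT) (f := fun i => if i = 0 then f else if i = 1 then g
    else fun _ => 0) (C := fun i => if i = 0 then C else if i = 1 then D else 0) fun i => by
      split_ifs
      · exact hf
      · exact hg
      · exact Superhedge.zero
  have two : ∀ u : ℕ → ℝ≥0∞, (∀ i, 2 ≤ i → u i = 0) → ∑' i, u i = u 0 + u 1 := fun u hu => by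
    rw [tsum_eq_sum (s := Finset.range 2) fun i hi =>
      hu i (not_lt.1 fun h => hi (Finset.mem_range.2 h))]
    simp [Finset.sum_range_succ]
  refine h.mono (fun ω => ?_) ?_
  · rw [two _ fun i hi => by simp [show i ≠ 0 by omega, show i ≠ 1 by omega]]
    simp
  · rw [two _ fun i hi => by simp [show i ≠ 0 by omega, show i ≠ 1 by omega]]
    simp

theorem Superhedge.sum_range {f : ℕ → Path T → ℝ≥0∞} {C : ℕ → ℝ≥0∞}
    (h : ∀ i, Superhedge hT (f i) (C i)) (n : ℕ) :
    Superhedge hT (fun ω => ∑ i ∈ Finset.range n, f i ω) (∑ i ∈ Finset.range n, C i) := by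
  induction n with
  | zero => simpa using Superhedge.zero
  | succ n ih =>
    simp only [Finset.sum_range_succ]
    exact ih.add (h n)

/-- The strategies are scaled down to total cost below `1`, and the remaining capital is kept
constant so that the positive capital process starts at exactly `1`. -/
theorem Superhedge.isNull {f : Path T → ℝ≥0∞} {C : ℝ≥0∞} (h : Superhedge hT f C) (hC : C ≠ ∞) :
    IsNull hT {ω | f ω = ∞} := by
  obtain ⟨G, h1, h2, h3⟩ := h
  have h0 : (0 : ℝ) ∈ Set.Icc 0 T := Set.left_mem_Icc.2 hT
  have hfin : ∑' n, ENNReal.ofReal (G n).c ≠ ∞ := ne_top_of_le_ne_top hC h2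
  let W : ℝ := (∑' n, ENNReal.ofReal (G n).c).toReal
  have hW : ENNReal.ofReal W = ∑' n, ENNReal.ofReal (G n).c := ENNReal.ofReal_toReal hfin
  have hW0 : 0 ≤ W := ENNReal.toReal_nonneg
  let r : ℝ := (W + 1)⁻¹
  have hr : 0 < r := by positivity
  let H : ℕ → SimpleStrategy T := fun n => Nat.casesOn n (constStrategy r) fun n => (G n).scale r
  have hH : ∀ n t ω, 0 ≤ (H n).capital t ω := by
    rintro (_ | n) t ω
    · simpa [H] using hr.le
    · simpa [H] using mul_nonneg hr.le (h1 n t ω)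
  have htsum : ∀ t ω, ∑' n, ENNReal.ofReal ((H n).capital t ω) = ENNReal.ofReal r +
      ENNReal.ofReal r * ∑' n, ENNReal.ofReal ((G n).capital t ω) := fun t ω => by
    rw [tsum_eq_zero_add' ENNReal.summable, ← ENNReal.tsum_mul_left]
    simp [H, ENNReal.ofReal_mul hr.le]
  have hinit : ∀ ω, ∑' n, ENNReal.ofReal ((H n).capital ⟨0, h0⟩ ω) = 1 := fun ω => by
    rw [htsum]
    simp only [SimpleStrategy.capital_zero]
    rw [← hW, ← ENNReal.ofReal_mul hr.le, ← ENNReal.ofReal_add hr.le (by positivity),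
      show r + r * W = 1 by simp only [r]; field_simp; ring, ENNReal.ofReal_one]
  refine ⟨fun t ω => ∑' n, ENNReal.ofReal ((H n).capital t ω),
    ⟨fun t => ?_, H, hH, ?_, fun _ _ => rfl⟩, hinit, fun ω hω => ?_⟩
  · let _ : MeasurableSpace (Path T) := pathFiltration T t
    exact Measurable.tsum fun n => ((H n).measurable_capital t).ennreal_ofReal
  · -- All initial capitals are values at time `0`, on any path.
    let ω : Path T := ⟨fun _ => 0, fun _ => le_rfl, fun _ => continuousWithinAt_const⟩
    have hc : ∀ n, 0 ≤ (H n).c := fun n => by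
      rw [← (H n).capital_zero h0 ω]
      exact hH n _ ω
    have h1' := hinit ω
    simp only [SimpleStrategy.capital_zero] at h1'
    have := ENNReal.summable_toReal (h1'.trans_ne ENNReal.one_ne_top)
    simpa only [ENNReal.toReal_ofReal (hc _)] using this
  · have hω' : f ω = ∞ := hω
    have htop : ∑' n, ENNReal.ofReal ((G n).capital ⟨T, Set.right_mem_Icc.2 hT⟩ ω) = ∞ :=
      top_le_iff.1 (hω' ▸ h3 ω)
    simp only [htsum]
    rw [htop, ENNReal.mul_top (by simpa using hr), add_top]

/-! ### Counting upcrossings -/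

/-- The number of upcrossings of `[a, b]` that `ω` completes by time `T`. -/
def upcrossings (hT : 0 ≤ T) (a b : ℝ) (ω : Path T) : ℝ≥0∞ :=
  ⨆ (m : ℕ) (_ : Visits (crossSets a b) (2 * m) ⟨T, Set.right_mem_Icc.2 hT⟩ ω), (m : ℝ≥0∞)

theorem le_upcrossings {a b : ℝ} {m : ℕ} {t : Set.Icc (0 : ℝ) T} {ω : Path T}
    (h : Visits (crossSets a b) (2 * m) t ω) : (m : ℝ≥0∞) ≤ upcrossings hT a b ω :=
  le_iSup₂_of_le (f := fun (m : ℕ)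
    (_ : Visits (crossSets a b) (2 * m) ⟨T, Set.right_mem_Icc.2 hT⟩ ω) => (m : ℝ≥0∞))
    m (h.mono_time t.2.2) le_rfl

/-- Doob's upcrossing inequality in superhedging form. -/
theorem superhedge_upcrossings {a b : ℝ} (ha : 0 ≤ a) (hab : a < b) (M : ℕ) :
    Superhedge hT (fun ω => min (upcrossings hT a b ω) M) (ENNReal.ofReal (a / (b - a))) := by
  have hba : 0 < b - a := sub_pos.2 hab
  have h := (Superhedge.of_strategy (hT := hT) (upcrossingStrategy a b M)
    (upcrossingStrategy_capital_nonneg ha hab.le M) fun ω => le_rfl).const_mul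
    (inv_nonneg.2 hba.le)
  refine h.mono (fun ω => ?_) ?_
  · rw [← ENNReal.ofReal_mul (inv_nonneg.2 hba.le)]
    have hK : ∀ m ≤ M, Visits (crossSets a b) (2 * m) ⟨T, Set.right_mem_Icc.2 hT⟩ ω →
        (m : ℝ≥0∞) ≤ ENNReal.ofReal ((b - a)⁻¹ *
          (upcrossingStrategy a b M).capital ⟨T, Set.right_mem_Icc.2 hT⟩ ω) := by
      intro m hm hv
      rw [← ENNReal.ofReal_natCast]
      refine ENNReal.ofReal_le_ofReal ?_
      rw [inv_mul_eq_div, le_div_iff₀ hba]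
      exact le_upcrossingStrategy_capital ha hab.le hm hv
    by_cases hM : Visits (crossSets a b) (2 * M) ⟨T, Set.right_mem_Icc.2 hT⟩ ω
    · exact (min_le_right _ _).trans (hK M le_rfl hM)
    · refine (min_le_left _ _).trans (iSup₂_le fun m hm => hK m ?_ hm)
      by_contra hlt
      exact hM (hm.anti (by omega))
  · rw [← ENNReal.ofReal_mul (inv_nonneg.2 hba.le), inv_mul_eq_div]
    rfl

open Classical in
theorem card_up_le_upcrossings (a b : ℝ) (ω : Path T) {κ : ℕ → Set.Icc (0 : ℝ) T}
    (hκ : Monotone κ) (n : ℕ) :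
    (((Finset.range n).filter fun i => ω (κ i) ≤ a ∧ b ≤ ω (κ (i + 1))).card : ℝ≥0∞) ≤
      upcrossings hT a b ω := by
  refine le_upcrossings (t := κ n) ?_
  induction n with
  | zero => trivial
  | succ n ih =>
    rw [Finset.range_add_one, Finset.filter_insert]
    split_ifs with h
    · rw [Finset.card_insert_of_notMem (by simp), mul_add]
      refine ((ih.snoc ?_).mono_time (hκ n.le_succ)).snoc ?_
      · rw [crossSets_two_mul]
        exact h.1
      · rw [crossSets_two_mul_add_one]
        exact h.2
    · exact ih.mono_time (hκ n.le_succ)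

open Classical in
/-- Between two downcrossings there is an upcrossing. -/
theorem card_down_le_upcrossings_add_one (a b : ℝ) (ω : Path T) {κ : ℕ → Set.Icc (0 : ℝ) T}
    (hκ : Monotone κ) (n : ℕ) :
    (((Finset.range n).filter fun i => ω (κ (i + 1)) ≤ a ∧ b ≤ ω (κ i)).card : ℝ≥0∞) ≤
      upcrossings hT a b ω + 1 := by
  have key : ∀ k, ((Finset.range n).filter fun i => ω (κ (i + 1)) ≤ a ∧ b ≤ ω (κ i)).card = k + 1 →
      Visits (crossSets a b) (2 * k + 1) (κ n) ω := by
    induction n with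
    | zero => simp
    | succ n ih =>
      intro k hk
      rw [Finset.range_add_one, Finset.filter_insert] at hk
      split_ifs at hk with h
      · rw [Finset.card_insert_of_notMem (by simp), add_left_inj] at hk
        have ha : ω (κ (n + 1)) ∈ crossSets a b (2 * k) := by
          rw [crossSets_two_mul]
          exact h.1
        refine Visits.snoc ?_ ha
        cases k with
        | zero => trivial
        | succ k =>
          refine ((ih k hk).snoc ?_).mono_time (hκ n.le_succ)
          rw [crossSets_two_mul_add_one]
          exact h.2
      · exact (ih k hk).mono_time (hκ n.le_succ)
  rcases h : ((Finset.range n).filter fun i => ω (κ (i + 1)) ≤ a ∧ b ≤ ω (κ i)).card with _ | k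
  · simp
  · push_cast
    gcongr
    exact le_upcrossings (key k h).of_succ

/-- An interval in `[0, L]` of length at least `2 * L / 2 ^ k` contains one of the `2 ^ k` cells of
the uniform subdivision of `[0, L]`. -/
theorem exists_cell_subset {L x y : ℝ} (hL : 0 < L) {k : ℕ} (hx : 0 ≤ x) (hy : y ≤ L)
    (hxy : 2 * (L / 2 ^ k) ≤ y - x) :
    ∃ j : ℕ, j < 2 ^ k ∧ x ≤ j * (L / 2 ^ k) ∧ (j + 1) * (L / 2 ^ k) ≤ y := by
  have hδ : 0 < L / 2 ^ k := by positivity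
  have h1 : x / (L / 2 ^ k) ≤ ⌈x / (L / 2 ^ k)⌉₊ := Nat.le_ceil _
  have h2 : (⌈x / (L / 2 ^ k)⌉₊ : ℝ) < x / (L / 2 ^ k) + 1 := Nat.ceil_lt_add_one (by positivity)
  set j := ⌈x / (L / 2 ^ k)⌉₊
  set δ := L / 2 ^ k with hδdef
  rw [div_le_iff₀ hδ] at h1
  have h3 : (j : ℝ) * δ < x + δ := by
    have := mul_lt_mul_of_pos_right h2 hδ
    rwa [add_mul, div_mul_cancel₀ _ hδ.ne', one_mul] at this
  refine ⟨j, ?_, h1, by linarith⟩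
  have h4 : (j : ℝ) * δ < 2 ^ k * δ := by
    rw [hδdef, mul_div_cancel₀ _ (by positivity), ← hδdef]
    linarith
  exact_mod_cast lt_of_mul_lt_mul_right h4 hδ.le

open Classical in
/-- At scale `L / 2 ^ k`, the number of increments of at least twice that size is controlled by the
upcrossings of the cells. -/
theorem card_large_increments_le {L : ℝ} (hL : 0 < L) {ω : Path T} (hω : ∀ t, ω t ≤ L)
    {κ : ℕ → Set.Icc (0 : ℝ) T} (hκ : Monotone κ) (n k : ℕ) :
    (((Finset.range n).filter fun i => 2 * (L / 2 ^ k) ≤ |ω (κ (i + 1)) - ω (κ i)|).card : ℝ≥0∞) ≤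
      ∑ j ∈ Finset.range (2 ^ k),
        (2 * upcrossings hT (j * (L / 2 ^ k)) ((j + 1) * (L / 2 ^ k)) ω + 1) := by
  let A : ℕ → Finset ℕ := fun j => (Finset.range n).filter fun i =>
    ω (κ i) ≤ j * (L / 2 ^ k) ∧ (j + 1) * (L / 2 ^ k) ≤ ω (κ (i + 1))
  let B : ℕ → Finset ℕ := fun j => (Finset.range n).filter fun i =>
    ω (κ (i + 1)) ≤ j * (L / 2 ^ k) ∧ (j + 1) * (L / 2 ^ k) ≤ ω (κ i)
  have hsub : ((Finset.range n).filter fun i => 2 * (L / 2 ^ k) ≤ |ω (κ (i + 1)) - ω (κ i)|) ⊆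
      (Finset.range (2 ^ k)).biUnion fun j => A j ∪ B j := by
    intro i hi
    rw [Finset.mem_filter] at hi
    simp only [Finset.mem_biUnion, Finset.mem_union, A, B, Finset.mem_filter, Finset.mem_range]
    have hin := Finset.mem_range.1 hi.1
    rcases le_abs.1 hi.2 with h | h
    · obtain ⟨j, hj, h1, h2⟩ := exists_cell_subset hL (ω.2.1 (κ i)) (hω (κ (i + 1))) h
      exact ⟨j, hj, Or.inl ⟨hin, h1, h2⟩⟩
    · rw [neg_sub] at h
      obtain ⟨j, hj, h1, h2⟩ := exists_cell_subset hL (ω.2.1 (κ (i + 1))) (hω (κ i)) h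
      exact ⟨j, hj, Or.inr ⟨hin, h1, h2⟩⟩
  have hcard := (Finset.card_le_card hsub).trans Finset.card_biUnion_le
  calc _ ≤ ((∑ j ∈ Finset.range (2 ^ k), (A j ∪ B j).card : ℕ) : ℝ≥0∞) := Nat.cast_le.2 hcard
    _ = ∑ j ∈ Finset.range (2 ^ k), ((A j ∪ B j).card : ℝ≥0∞) := Nat.cast_sum _ _
    _ ≤ _ := by
      refine Finset.sum_le_sum fun j _ => ?_
      calc ((A j ∪ B j).card : ℝ≥0∞) ≤ ((A j).card + (B j).card : ℕ) :=
            Nat.cast_le.2 (Finset.card_union_le _ _)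
        _ = (A j).card + (B j).card := Nat.cast_add _ _
        _ ≤ upcrossings hT (j * (L / 2 ^ k)) ((j + 1) * (L / 2 ^ k)) ω +
            (upcrossings hT (j * (L / 2 ^ k)) ((j + 1) * (L / 2 ^ k)) ω + 1) :=
          add_le_add (card_up_le_upcrossings _ _ ω hκ n)
            (card_down_le_upcrossings_add_one _ _ ω hκ n)
        _ = _ := by ring

/-! ### From upcrossings to the `p`-variation -/

theorem pVariation_le {p : ℝ} {f : Set.Icc (0 : ℝ) T → ℝ} {C : ℝ≥0∞}
    (h : ∀ (n : ℕ) (κ : ℕ → Set.Icc (0 : ℝ) T), Monotone κ →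
      ∑ i ∈ Finset.range n, ENNReal.ofReal (|f (κ (i + 1)) - f (κ i)| ^ p) ≤ C) :
    pVariation p f ≤ C := by
  refine iSup_le fun n => iSup_le fun _ => iSup_le fun κ => iSup_le fun hκ => ?_
  refine le_of_eq_of_le ?_ (h n (fun i => κ ⟨min i n, by omega⟩) fun i j hij =>
    hκ.1 (Fin.mk_le_mk.2 (min_le_min_right n hij)))
  rw [Finset.sum_range]
  refine Finset.sum_congr rfl fun i _ => ?_
  have h1 : (⟨min ((i : ℕ) + 1) n, by omega⟩ : Fin (n + 1)) = i.succ :=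
    Fin.ext (min_eq_left i.2)
  have h2 : (⟨min (i : ℕ) n, by omega⟩ : Fin (n + 1)) = i.castSucc :=
    Fin.ext (min_eq_left i.2.le)
  rw [h1, h2]

/-- Every `d ∈ (0, L]` is comparable to one of the scales `L / 2 ^ k`, `k ≥ k₀`. The constant
`2 ^ (k₀ + 2)` accounts for large `d`, for which the scale `k = k₀` is used. -/
theorem exists_scale {L d : ℝ} (hL : 0 < L) (hd : 0 < d) (hdL : d ≤ L) (k₀ : ℕ) :
    ∃ k ≥ k₀, 2 * (L / 2 ^ k) ≤ d ∧ d ≤ 2 ^ (k₀ + 2) * (L / 2 ^ k) := by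
  classical
  have hex : ∃ k, k₀ ≤ k ∧ 2 * (L / 2 ^ k) ≤ d := by
    have hlim : Tendsto (fun k : ℕ => 2 * (L / 2 ^ k)) atTop (𝓝 0) := by
      have := ((tendsto_pow_atTop_nhds_zero_of_lt_one (r := (1 / 2 : ℝ)) (by norm_num)
        (by norm_num)).const_mul L).const_mul 2
      simpa [div_eq_mul_inv] using this
    exact ((eventually_ge_atTop k₀).and (hlim.eventually_le_const hd)).exists
  refine ⟨Nat.find hex, (Nat.find_spec hex).1, (Nat.find_spec hex).2, ?_⟩
  rcases (Nat.find_spec hex).1.eq_or_lt with h | h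
  · rw [← h, pow_add]
    have : (2 : ℝ) ^ k₀ * 2 ^ 2 * (L / 2 ^ k₀) = 4 * L := by
      field_simp
      norm_num
    linarith
  · obtain ⟨m, hm⟩ : ∃ m, Nat.find hex = m + 1 := ⟨Nat.find hex - 1, by omega⟩
    have hnot := Nat.find_min hex (m := m) (by omega)
    have hlt : d < 2 * (L / 2 ^ m) := by
      by_contra hle
      exact hnot ⟨by omega, not_lt.1 hle⟩
    have h1 : (1 : ℝ) ≤ 2 ^ k₀ := one_le_pow₀ (by norm_num)
    have h2 : (2 : ℝ) ^ (k₀ + 2) * (L / 2 ^ (m + 1)) = 2 ^ k₀ * (2 * (L / 2 ^ m)) := by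
      rw [pow_add, pow_succ 2 m]
      field_simp
    rw [hm, h2]
    have : 0 < 2 * (L / 2 ^ m) := by positivity
    nlinarith

theorem summable_sq_mul_four_pow_mul_rpow {p D : ℝ} (hp : 2 < p) (hD : 0 < D) :
    Summable fun k : ℕ => (4 : ℝ) ^ k * ((k : ℝ) + 1) ^ 2 * (D / 2 ^ k) ^ p := by
  let r : ℝ := 4 / 2 ^ p
  have h2p : (4 : ℝ) < 2 ^ p := by
    calc (4 : ℝ) = 2 ^ (2 : ℝ) := by norm_num
      _ < 2 ^ p := Real.rpow_lt_rpow_of_exponent_lt (by norm_num) hp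
  have hr0 : 0 < r := by positivity
  have hr : r < 1 := (div_lt_one (by linarith)).2 h2p
  have h := summable_pow_mul_geometric_of_norm_lt_one 2 (r := r)
    (by rwa [Real.norm_of_nonneg hr0.le])
  have h' := ((summable_nat_add_iff 1).2 h).mul_left (D ^ p / r)
  refine h'.congr fun k => ?_
  rw [Real.div_rpow hD.le (by positivity), ← Real.rpow_natCast, ← Real.rpow_natCast 2 k,
    ← Real.rpow_mul (by norm_num), mul_comm (k : ℝ) p, Real.rpow_mul (by norm_num) p,
    Real.rpow_natCast, Real.rpow_natCast, pow_succ r]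
  simp only [r, div_pow]
  push_cast
  field_simp

/-- If the total number of upcrossings of the cells of size `L / 2 ^ k` is, up to a polynomial
factor, of order `4 ^ k`, then the `p`-variation is finite for all `p > 2`: there are about `4 ^ k`
increments of order `2 ^ (-k)`. -/
theorem pVariation_lt_top_of_upcrossings_le {L : ℝ} (hL : 0 < L) {ω : Path T}
    (hω : ∀ t, ω t ≤ L) {C : ℝ≥0∞} (hC : C ≠ ∞) (k₀ : ℕ)
    (h : ∀ k ≥ k₀, ∑ j ∈ Finset.range (2 ^ k),
      (2 * upcrossings hT (j * (L / 2 ^ k)) ((j + 1) * (L / 2 ^ k)) ω + 1) ≤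
        C * ENNReal.ofReal (4 ^ k * (k + 1) ^ 2)) {p : ℝ} (hp : 2 < p) :
    pVariation p ω < ∞ := by
  classical
  let D : ℝ := 2 ^ (k₀ + 2) * L
  have hD : 0 < D := by positivity
  let B : ℝ≥0∞ := ∑' k : ℕ, C * ENNReal.ofReal (4 ^ k * (k + 1) ^ 2 * (D / 2 ^ k) ^ p)
  have hB : B < ∞ := by
    simp only [B, ENNReal.tsum_mul_left]
    exact ENNReal.mul_lt_top hC.lt_top
      (summable_sq_mul_four_pow_mul_rpow hp hD).tsum_ofReal_lt_top
  refine lt_of_le_of_lt (pVariation_le fun n κ hκ => ?_) hB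
  let d : ℕ → ℝ := fun i => |ω (κ (i + 1)) - ω (κ i)|
  have hdL : ∀ i, d i ≤ L := fun i => abs_le.2
    ⟨by linarith [ω.2.1 (κ (i + 1)), hω (κ i)], by linarith [ω.2.1 (κ i), hω (κ (i + 1))]⟩
  let P : ℕ → ℕ → Prop := fun k i => 2 * (L / 2 ^ k) ≤ d i
  -- Each nonzero increment is charged to a scale at which it is large.
  have hterm : ∀ i, ENNReal.ofReal (d i ^ p) ≤
      ∑' k, if k₀ ≤ k ∧ P k i then ENNReal.ofReal ((D / 2 ^ k) ^ p) else 0 := by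
    intro i
    rcases (show 0 ≤ d i from abs_nonneg _).eq_or_lt with h0 | h0
    · have hz : d i ^ p = 0 := by rw [← h0, Real.zero_rpow (by linarith)]
      rw [hz, ENNReal.ofReal_zero]
      exact zero_le
    · obtain ⟨k, hk, h1, h2⟩ := exists_scale hL h0 (hdL i) k₀
      refine le_trans ?_ (ENNReal.le_tsum k)
      rw [if_pos ⟨hk, h1⟩]
      refine ENNReal.ofReal_le_ofReal (Real.rpow_le_rpow h0.le ?_ (by linarith))
      simpa only [D, mul_div_assoc] using h2
  calc ∑ i ∈ Finset.range n, ENNReal.ofReal (d i ^ p)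
      ≤ ∑ i ∈ Finset.range n,
        ∑' k, (if k₀ ≤ k ∧ P k i then ENNReal.ofReal ((D / 2 ^ k) ^ p) else 0) :=
        Finset.sum_le_sum fun i _ => hterm i
    _ = ∑' k, ∑ i ∈ Finset.range n,
          (if k₀ ≤ k ∧ P k i then ENNReal.ofReal ((D / 2 ^ k) ^ p) else 0) :=
        (Summable.tsum_finsetSum fun _ _ => ENNReal.summable).symm
    _ ≤ B := by
      refine ENNReal.tsum_le_tsum fun k => ?_
      by_cases hk : k₀ ≤ k
      · simp only [hk, true_and]
        rw [← Finset.sum_filter, Finset.sum_const, nsmul_eq_mul, ENNReal.ofReal_mul (by positivity),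
          ← mul_assoc]
        gcongr
        exact (card_large_increments_le hL hω hκ n k).trans (h k hk)
      · simp [hk]

/-! ### The payoffs that detect paths of large variation -/

/-- The total number of upcrossings of the cells of size `L / 2 ^ k`, weighted and summed over `k`.
The number of upcrossings of each cell is truncated, so that only finitely many trades are needed;
the truncation level exceeds the inverse of the weight by an unbounded factor `k + 1`. -/
def crossingPayoff (hT : 0 ≤ T) (L : ℝ) (ω : Path T) : ℝ≥0∞ :=
  ∑' k : ℕ, ENNReal.ofReal ((4 ^ k * ((k : ℝ) + 1) ^ 2)⁻¹) * ∑ j ∈ Finset.range (2 ^ k),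
    min (upcrossings hT (j * (L / 2 ^ k)) ((j + 1) * (L / 2 ^ k)) ω)
      ((4 ^ k * (k + 1) ^ 3 : ℕ) : ℝ≥0∞)

theorem superhedge_crossingPayoff {L : ℝ} (hL : 0 < L) :
    Superhedge hT (crossingPayoff hT L) (∑' k : ℕ, ENNReal.ofReal ((((k : ℝ) + 1) ^ 2)⁻¹)) := by
  have h := Superhedge.tsum_nat (hT := hT) fun k : ℕ => (Superhedge.sum_range (fun j : ℕ =>
    superhedge_upcrossings (hT := hT) (a := j * (L / 2 ^ k)) (b := (j + 1) * (L / 2 ^ k))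
      (by positivity) (by gcongr; linarith) (4 ^ k * (k + 1) ^ 3)) (2 ^ k)).const_mul
        (r := (4 ^ k * ((k : ℝ) + 1) ^ 2)⁻¹) (by positivity)
  refine h.mono (fun ω => le_rfl) (ENNReal.tsum_le_tsum fun k => ?_)
  have hcell : ∀ j ∈ Finset.range (2 ^ k), j * (L / 2 ^ k) /
      ((j + 1) * (L / 2 ^ k) - j * (L / 2 ^ k)) ≤ (2 : ℝ) ^ k := by
    intro j hj
    have hj' : (j : ℝ) ≤ 2 ^ k := by exact_mod_cast (Finset.mem_range.1 hj).le
    have hδ : L / 2 ^ k ≠ 0 := by positivity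
    rwa [← sub_mul, add_sub_cancel_left, one_mul, mul_div_cancel_right₀ _ hδ]
  calc _ ≤ ENNReal.ofReal ((4 ^ k * ((k : ℝ) + 1) ^ 2)⁻¹) *
        ∑ _j ∈ Finset.range (2 ^ k), ENNReal.ofReal (2 ^ k) := by
        gcongr with j hj
        exact hcell j hj
    _ = ENNReal.ofReal ((4 ^ k * ((k : ℝ) + 1) ^ 2)⁻¹) * ENNReal.ofReal (2 ^ k * 2 ^ k) := by
        rw [Finset.sum_const, Finset.card_range, nsmul_eq_mul, ENNReal.ofReal_mul (by positivity)]
        congr 2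
        rw [← ENNReal.ofReal_natCast]
        push_cast
        rfl
    _ = ENNReal.ofReal ((((k : ℝ) + 1) ^ 2)⁻¹) := by
        rw [← ENNReal.ofReal_mul (by positivity), ← mul_pow]
        congr 1
        norm_num

/-- On a bounded path where `crossingPayoff` is finite, the truncation is eventually inactive. -/
theorem pVariation_lt_top_of_crossingPayoff_ne_top {L : ℝ} (hL : 0 < L) {ω : Path T}
    (hω : ∀ t, ω t ≤ L) (h : crossingPayoff hT L ω ≠ ∞) {p : ℝ} (hp : 2 < p) :
    pVariation p ω < ∞ := by
  set C := crossingPayoff hT L ω with hC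
  obtain ⟨k₀, hk₀⟩ := exists_nat_gt C.toReal
  refine pVariation_lt_top_of_upcrossings_le (hT := hT) hL hω
    (C := 2 * C + 1) (by finiteness) k₀ (fun k hk => ?_) hp
  -- For `k ≥ k₀ > C`, the total truncated number of upcrossings is below the truncation level.
  let U : ℕ → ℝ≥0∞ := fun j => upcrossings hT (j * (L / 2 ^ k)) ((j + 1) * (L / 2 ^ k)) ω
  let M : ℕ := 4 ^ k * (k + 1) ^ 3
  let w : ℝ := 4 ^ k * ((k : ℝ) + 1) ^ 2
  have hw : 0 < w := by positivity
  have hsum : ∑ j ∈ Finset.range (2 ^ k), min (U j) M ≤ C * ENNReal.ofReal w := by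
    have h1 : ENNReal.ofReal w⁻¹ * ∑ j ∈ Finset.range (2 ^ k), min (U j) M ≤ C :=
      ENNReal.le_tsum (f := fun k : ℕ => ENNReal.ofReal ((4 ^ k * ((k : ℝ) + 1) ^ 2)⁻¹) *
        ∑ j ∈ Finset.range (2 ^ k),
          min (upcrossings hT (j * (L / 2 ^ k)) ((j + 1) * (L / 2 ^ k)) ω)
            ((4 ^ k * (k + 1) ^ 3 : ℕ) : ℝ≥0∞)) k
    rw [ENNReal.ofReal_inv_of_pos hw, mul_comm, ← div_eq_mul_inv] at h1
    exact (ENNReal.div_le_iff (by simpa using hw) ENNReal.ofReal_ne_top).1 h1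
  have hlt : C * ENNReal.ofReal w < M := by
    rw [← ENNReal.ofReal_toReal h, ← ENNReal.ofReal_mul ENNReal.toReal_nonneg,
      ← ENNReal.ofReal_natCast]
    refine (ENNReal.ofReal_lt_ofReal_iff (by positivity)).2 ?_
    have hCk : C.toReal < (k : ℝ) + 1 :=
      hk₀.trans_le ((Nat.cast_le.2 hk).trans (le_add_of_nonneg_right zero_le_one))
    calc C.toReal * w < ((k : ℝ) + 1) * w := mul_lt_mul_of_pos_right hCk hw
      _ = (M : ℝ) := by
        simp only [w, M]
        push_cast
        ring
  have hmin : ∀ j ∈ Finset.range (2 ^ k), min (U j) M = U j := by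
    intro j hj
    have h1 : min (U j) M < M :=
      ((Finset.single_le_sum (f := fun j => min (U j) (M : ℝ≥0∞)) (fun _ _ => zero_le) hj).trans
        hsum).trans_lt hlt
    exact min_eq_left (lt_of_not_ge fun hle => h1.ne (min_eq_right hle)).le
  rw [Finset.sum_congr rfl hmin] at hsum
  change ∑ j ∈ Finset.range (2 ^ k), (2 * U j + 1) ≤ (2 * C + 1) * ENNReal.ofReal w
  rw [Finset.sum_add_distrib, ← Finset.mul_sum, add_mul, one_mul, mul_assoc]
  gcongr
  rw [Finset.sum_const, Finset.card_range, nsmul_eq_mul, mul_one, ← ENNReal.ofReal_natCast]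
  refine ENNReal.ofReal_le_ofReal ?_
  push_cast
  calc (2 : ℝ) ^ k ≤ 4 ^ k := by gcongr; norm_num
    _ ≤ w := le_mul_of_one_le_right (by positivity)
      (one_le_pow₀ (by linarith [k.cast_nonneg (α := ℝ)]))

/-- The number of the intervals `[l + 1, (l + 1) * (1 + 2 ^ k)]`, `k = 0, 1, …`, that the path
upcrosses: it is infinite if the path starts below `l + 1` and is unbounded. -/
def unboundedPayoff (hT : 0 ≤ T) (l : ℕ) (ω : Path T) : ℝ≥0∞ :=
  ∑' k : ℕ, min (upcrossings hT ((l : ℝ) + 1) (((l : ℝ) + 1) * (1 + 2 ^ k)) ω) ((1 : ℕ) : ℝ≥0∞)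

theorem superhedge_unboundedPayoff (l : ℕ) : Superhedge hT (unboundedPayoff hT l) 2 := by
  have h := Superhedge.tsum_nat (hT := hT) fun k : ℕ =>
    superhedge_upcrossings (hT := hT) (a := (l : ℝ) + 1) (b := ((l : ℝ) + 1) * (1 + 2 ^ k))
      (by positivity) (lt_mul_of_one_lt_right (by positivity) (by simp)) 1
  refine h.mono (fun ω => le_rfl) ?_
  have hcost : ∀ k : ℕ, ((l : ℝ) + 1) / (((l : ℝ) + 1) * (1 + 2 ^ k) - ((l : ℝ) + 1)) =
      (1 / 2) ^ k := by
    intro k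
    rw [mul_add, mul_one, add_sub_cancel_left, one_div, inv_pow]
    field_simp
  simp only [hcost]
  rw [← ENNReal.ofReal_tsum_of_nonneg (fun _ => by positivity) summable_geometric_two,
    tsum_geometric_two]
  simp

theorem unboundedPayoff_eq_top {l : ℕ} {ω : Path T} (h0 : ω ⟨0, Set.left_mem_Icc.2 hT⟩ ≤ l)
    (h : ∀ L : ℝ, ∃ t, L < ω t) : unboundedPayoff hT l ω = ∞ := by
  refine top_le_iff.1 ?_
  rw [← ENNReal.tsum_const_eq_top_of_ne_zero (α := ℕ) one_ne_zero]
  refine ENNReal.tsum_le_tsum fun k => le_min ?_ (by simp)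
  obtain ⟨t, ht⟩ := h (((l : ℝ) + 1) * (1 + 2 ^ k))
  set b := ((l : ℝ) + 1) * (1 + 2 ^ k)
  have hv : Visits (crossSets ((l : ℝ) + 1) b) (2 * 1) t ω := by
    refine ⟨t, le_rfl, ⟨⟨0, Set.left_mem_Icc.2 hT⟩, t.2.1, trivial, ?_⟩, ?_⟩
    · have hmem : ω ⟨0, Set.left_mem_Icc.2 hT⟩ ∈ Set.Iic ((l : ℝ) + 1) := h0.trans (by simp)
      exact (crossSets_two_mul ((l : ℝ) + 1) b 0).symm ▸ hmem
    · exact (crossSets_two_mul_add_one ((l : ℝ) + 1) b 0).symm ▸ ht.le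
  simpa using le_upcrossings (hT := hT) hv

/-- A payoff of finite superhedging cost that is infinite on all paths of variation index above
`2`. -/
def variationPayoff (hT : 0 ≤ T) (ω : Path T) : ℝ≥0∞ :=
  ∑' l : ℕ, ENNReal.ofReal ((1 / 2) ^ l) *
    (crossingPayoff hT ((l : ℝ) + 1) ω + unboundedPayoff hT l ω)

theorem exists_superhedge_variationPayoff :
    ∃ C ≠ ∞, Superhedge hT (variationPayoff hT) C := by
  refine ⟨_, ?_, Superhedge.tsum_nat fun l : ℕ => ((superhedge_crossingPayoff
    (by positivity : 0 < (l : ℝ) + 1)).add (superhedge_unboundedPayoff l)).const_mul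
    (by positivity : (0 : ℝ) ≤ (1 / 2) ^ l)⟩
  rw [ENNReal.tsum_mul_right]
  refine ENNReal.mul_ne_top summable_geometric_two.tsum_ofReal_ne_top
    (ENNReal.add_ne_top.2 ⟨Summable.tsum_ofReal_ne_top ?_, by simp⟩)
  simpa using (summable_nat_add_iff 1).2 (Real.summable_nat_pow_inv.2 one_lt_two)

theorem variationIndex_le_two_of_variationPayoff_ne_top {ω : Path T}
    (h : variationPayoff hT ω ≠ ∞) : variationIndex ω ≤ 2 := by
  have hl : ∀ l : ℕ, crossingPayoff hT ((l : ℝ) + 1) ω + unboundedPayoff hT l ω ≠ ∞ := by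
    intro l htop
    refine ENNReal.ne_top_of_tsum_ne_top h l ?_
    rw [htop, ENNReal.mul_top (by simp)]
  obtain ⟨L, hL⟩ : ∃ L : ℝ, ∀ t, ω t ≤ L := by
    by_contra! hunb
    obtain ⟨l, hl0⟩ := exists_nat_ge (ω ⟨0, Set.left_mem_Icc.2 hT⟩)
    exact (ENNReal.add_ne_top.1 (hl l)).2 (unboundedPayoff_eq_top hl0 hunb)
  obtain ⟨l, hLl⟩ := exists_nat_ge L
  have hfin : ∀ p : ℝ, 2 < p → pVariation p ω < ∞ := fun p hp =>
    pVariation_lt_top_of_crossingPayoff_ne_top (hT := hT) (by positivity : 0 < (l : ℝ) + 1)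
      (fun t => (hL t).trans (by linarith)) (ENNReal.add_ne_top.1 (hl l)).1 hp
  refine le_of_forall_gt_imp_ge_of_dense fun v hv => ?_
  obtain ⟨q, hq2, hqv⟩ := ENNReal.lt_iff_exists_real_btwn.1 hv |>.imp fun q hq => hq.2
  have hq : 2 < q := by
    have : ENNReal.ofReal 2 < ENNReal.ofReal q := by simpa using hq2
    exact (ENNReal.ofReal_lt_ofReal_iff_of_nonneg zero_le_two).1 this
  have hle : variationIndex ω ≤ ENNReal.ofReal q := sInf_le ⟨q, by linarith, hfin q hq, rfl⟩
  exact hle.trans hqv.le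

end RCPath

end

theorem mainTheorem4 (T : ℝ) (hT : 0 ≤ T) :
    RCPath.ForTypical hT (fun ω : RCPath.Path T => RCPath.variationIndex ω ≤ 2) := by
  obtain ⟨C, hC, h⟩ := RCPath.exists_superhedge_variationPayoff (hT := hT)
  obtain ⟨S, hS, hS0, hST⟩ := h.isNull hC
  refine ⟨S, hS, hS0, fun ω hω => hST ω ?_⟩
  by_contra hne
  exact hω (RCPath.variationIndex_le_two_of_variationPayoff_ne_top hne)
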